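/- Let $n\ge 1$ and let $D\subset\mathbb{C}^n$ be a domain (a nonempty connected open set) that is bounded and smoothly bounded, i.e. there are an open neighborhood $V$ of the boundary $bD$ and a function $\rho\in C^\infty(V;\mathbb{R})$ such that $d\rho\neq 0$ on $bD$ and $D\cap V=\{z\in V:\rho(z)<0\}$. Let $\lambda$ be the $2n$-dimensional Lebesgue measure on $\mathbb{C}^n$, let $A^2(D)$ be the closed subspace of $L^2(D)=L^2(D,\lambda)$ of square-integrable holomorphic functions on $D$, and let the Bergman projection $B_D$ be the orthogonal projection of $L^2(D)$ onto $A^2(D)$. Then $B_D$ is unbounded on $L^1$: there is no finite constant $C$ such that \[ \|B_D f\|_{L^1(D)}\le C\,\|f\|_{L^1(D)}\qquad\text{for all } f\in L^2(D)\cap L^1(D). \] -/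

import Mathlib

namespace Bergman

open MeasureTheory TopologicalSpace Filter Topology
open scoped ContDiff

/-! `ℂⁿ` is `Fin n → ℂ`; its `volume` is the standard `2n`-dimensional Lebesgue measure (the
product of the planar Lebesgue measures). -/

/-- `D` admits a smooth defining function: a smooth real function `ρ` on an open neighbourhood `V`
of the boundary of `D` such that `dρ ≠ 0` on the boundary and `D ∩ V = {ρ < 0}`. -/
def IsSmoothlyBounded {n : ℕ} (D : Set (Fin n → ℂ)) : Prop :=
  ∃ (V : Set (Fin n → ℂ)) (ρ : (Fin n → ℂ) → ℝ),
    IsOpen V ∧ frontier D ⊆ V ∧ ContDiffOn ℝ ∞ ρ V ∧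
    (∀ z ∈ frontier D, fderiv ℝ ρ z ≠ 0) ∧ D ∩ V = {z ∈ V | ρ z < 0}

/-- The a priori bound `‖P f‖_p ≤ C ‖f‖_p` for all `f ∈ L² ∩ L^p`, for some finite `C`. -/
def IsBoundedOnLp {X : Type*} [MeasurableSpace X] {μ : Measure X}
    (P : Lp ℂ 2 μ →L[ℂ] Lp ℂ 2 μ) (p : ENNReal) : Prop :=
  ∃ C : NNReal, ∀ f : Lp ℂ 2 μ, MemLp f p μ → eLpNorm (P f) p μ ≤ C * eLpNorm f p μ

/-- Mean value inequality for holomorphic functions on polydiscs. -/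
theorem enorm_mul_volume_ball_le {n : ℕ} {f : (Fin n → ℂ) → ℂ} {z : Fin n → ℂ} {r : ℝ}
    (hf : DifferentiableOn ℂ f (Metric.ball z r)) :
    ‖f z‖ₑ * volume (Metric.ball (0 : Fin n → ℂ) r) ≤ ∫⁻ w in Metric.ball z r, ‖f w‖ₑ := by
  set g : (Fin n → ℂ) → ℂ := (Metric.ball z r).indicator f with hg
  have hgm : Measurable g := by
    classical
    rw [hg, ← Set.piecewise_eq_indicator]
    exact hf.continuousOn.measurable_piecewise continuousOn_const measurableSet_ball
  have hmean : ∀ w ∈ Metric.ball (0 : Fin n → ℂ) r, ‖f z‖ₑ ≤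
      ENNReal.ofReal (2 * Real.pi)⁻¹ *
        ∫⁻ θ in Set.Ioc 0 (2 * Real.pi), ‖g (z + circleMap 0 1 θ • w)‖ₑ := by
    intro w hw
    have hw' : ‖w‖ < r := by simpa using hw
    have hmem : ∀ ζ : ℂ, ‖ζ‖ ≤ 1 → z + ζ • w ∈ Metric.ball z r := by
      intro ζ hζ
      rw [Metric.mem_ball, dist_eq_norm, add_sub_cancel_left, norm_smul]
      nlinarith [norm_nonneg w, norm_nonneg ζ]
    have hd : DifferentiableOn ℂ (fun ζ : ℂ => f (z + ζ • w)) (Metric.closedBall 0 1) := by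
      apply hf.comp (g := f) (f := fun ζ : ℂ => z + ζ • w)
      · fun_prop
      · intro ζ hζ
        exact hmem ζ (by simpa using hζ)
    have hc := circleAverage_of_differentiable_on_off_countable (f := fun ζ : ℂ => f (z + ζ • w))
      (c := 0) (R := 1) (s := ∅) Set.countable_empty (by simpa using hd.continuousOn)
      (fun ζ hζ => (hd ζ (Metric.ball_subset_closedBall (by simpa using hζ))).differentiableAt
        (Metric.closedBall_mem_nhds_of_mem (by simpa using hζ)))
    simp only [zero_smul, add_zero] at hc
    rw [← hc, Real.circleAverage_def, enorm_smul, intervalIntegral.integral_of_le (by positivity)]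
    rw [Real.enorm_of_nonneg (by positivity)]
    gcongr
    refine (enorm_integral_le_lintegral_enorm _).trans (le_of_eq ?_)
    congr 1 with θ
    rw [hg, Set.indicator_of_mem (hmem _ (by simp))]
  have hrot : ∀ θ : ℝ, ∫⁻ w in Metric.ball (0 : Fin n → ℂ) r, ‖g (z + circleMap 0 1 θ • w)‖ₑ =
      ∫⁻ w in Metric.ball z r, ‖f w‖ₑ := by
    intro θ
    have hp : MeasurePreserving (fun w : Fin n → ℂ => circleMap 0 1 θ • w) volume volume := by
      refine volume_preserving_pi (f := fun _ w => circleMap 0 1 θ * w) fun _ => ?_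
      have h : (fun w : ℂ => circleMap 0 1 θ * w) = rotation (Circle.exp θ) := by
        funext w
        simp [circleMap, rotation_apply]
      rw [h]
      exact (rotation (Circle.exp θ)).measurePreserving
    have hp2 : MeasurePreserving (fun w : Fin n → ℂ => z + circleMap 0 1 θ • w) volume volume :=
      (measurePreserving_add_left volume z).comp hp
    have hpre : (fun w : Fin n → ℂ => z + circleMap 0 1 θ • w) ⁻¹' Metric.ball z r =
        Metric.ball 0 r := by
      ext w; simp [norm_smul]
    rw [← hpre, hp2.setLIntegral_comp_preimage measurableSet_ball (f := fun w => ‖g w‖ₑ)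
      hgm.enorm]
    refine setLIntegral_congr_fun measurableSet_ball fun w hw => ?_
    simp only [hg, Set.indicator_of_mem hw]
  have hjm : Measurable (fun p : (Fin n → ℂ) × ℝ => ‖g (z + circleMap 0 1 p.2 • p.1)‖ₑ) := by
    refine (hgm.comp ?_).enorm
    have : Continuous (fun p : (Fin n → ℂ) × ℝ => z + circleMap 0 1 p.2 • p.1) := by
      have := continuous_circleMap 0 1
      fun_prop
    exact this.measurable
  calc ‖f z‖ₑ * volume (Metric.ball (0 : Fin n → ℂ) r)
      = ∫⁻ w in Metric.ball (0 : Fin n → ℂ) r, ‖f z‖ₑ := by simp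
    _ ≤ ∫⁻ w in Metric.ball (0 : Fin n → ℂ) r, ENNReal.ofReal (2 * Real.pi)⁻¹ *
        ∫⁻ θ in Set.Ioc 0 (2 * Real.pi), ‖g (z + circleMap 0 1 θ • w)‖ₑ :=
        setLIntegral_mono' measurableSet_ball hmean
    _ = ENNReal.ofReal (2 * Real.pi)⁻¹ * ∫⁻ w in Metric.ball (0 : Fin n → ℂ) r,
        ∫⁻ θ in Set.Ioc 0 (2 * Real.pi), ‖g (z + circleMap 0 1 θ • w)‖ₑ := by
        rw [lintegral_const_mul' _ _ ENNReal.ofReal_ne_top]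
    _ = ENNReal.ofReal (2 * Real.pi)⁻¹ * ∫⁻ θ in Set.Ioc 0 (2 * Real.pi),
        ∫⁻ w in Metric.ball (0 : Fin n → ℂ) r, ‖g (z + circleMap 0 1 θ • w)‖ₑ := by
        rw [lintegral_lintegral_swap hjm.aemeasurable]
    _ = ∫⁻ w in Metric.ball z r, ‖f w‖ₑ := by
        simp only [hrot, lintegral_const, Measure.restrict_apply MeasurableSet.univ,
          Set.univ_inter, Real.volume_Ioc, sub_zero]
        rw [mul_comm, mul_assoc, ← ENNReal.ofReal_mul (by positivity),
          mul_inv_cancel₀ (by positivity), ENNReal.ofReal_one, mul_one]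

/-- The Bergman space `A²(D)`: square-integrable functions on the open set `D` (for the
`2n`-dimensional Lebesgue measure) that are represented by a function holomorphic on `D`. -/
def bergmanSpace {n : ℕ} (D : Opens (Fin n → ℂ)) :
    Submodule ℂ (Lp ℂ 2 (volume.restrict (D : Set (Fin n → ℂ)))) where
  carrier := {f | ∃ g : (Fin n → ℂ) → ℂ, DifferentiableOn ℂ g D ∧
    f =ᵐ[volume.restrict (D : Set (Fin n → ℂ))] g}
  zero_mem' := ⟨0, differentiableOn_const 0, Lp.coeFn_zero _ _ _⟩
  add_mem' := by
    rintro f₁ f₂ ⟨g₁, hg₁, h₁⟩ ⟨g₂, hg₂, h₂⟩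
    exact ⟨g₁ + g₂, hg₁.add hg₂, (Lp.coeFn_add f₁ f₂).trans (h₁.add h₂)⟩
  smul_mem' := by
    rintro c f ⟨g, hg, h⟩
    exact ⟨c • g, hg.const_smul c, (Lp.coeFn_smul c f).trans (h.const_smul c)⟩

/-- Point evaluations are bounded on the Bergman space. -/
theorem norm_le_of_mem {n : ℕ} {D : Opens (Fin n → ℂ)} {r : ℝ} (hr : 0 < r) :
    ∃ C : ℝ, 0 ≤ C ∧ ∀ (F : Lp ℂ 2 (volume.restrict (D : Set (Fin n → ℂ))))
      (g : (Fin n → ℂ) → ℂ), DifferentiableOn ℂ g D →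
      F =ᵐ[volume.restrict (D : Set (Fin n → ℂ))] g →
      ∀ z, Metric.ball z r ⊆ D → ‖g z‖ ≤ C * ‖F‖ := by
  set v := volume (Metric.ball (0 : Fin n → ℂ) r) with hv
  have hv0 : 0 < v := Metric.measure_ball_pos _ _ hr
  have hvt : v ≠ ⊤ := measure_ball_lt_top.ne
  have hvr : 0 < v.toReal := ENNReal.toReal_pos hv0.ne' hvt
  refine ⟨(Real.sqrt v.toReal)⁻¹, by positivity, fun F g hg hFg z hz => ?_⟩
  have h1 := enorm_mul_volume_ball_le (f := fun w => g w ^ 2) (z := z) (r := r)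
    ((hg.mono hz).pow 2)
  have h2 : ∫⁻ w in Metric.ball z r, ‖g w ^ 2‖ₑ ≤ ‖F‖ₑ ^ 2 := by
    calc ∫⁻ w in Metric.ball z r, ‖g w ^ 2‖ₑ
        ≤ ∫⁻ w in (D : Set (Fin n → ℂ)), ‖g w ^ 2‖ₑ := lintegral_mono_set hz
      _ = ∫⁻ w in (D : Set (Fin n → ℂ)), ‖F w‖ₑ ^ (2 : ℝ) := by
          refine lintegral_congr_ae ?_
          filter_upwards [hFg] with w hw
          rw [hw, enorm_pow]
          norm_cast
      _ = ‖F‖ₑ ^ 2 := by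
          rw [Lp.enorm_def, eLpNorm_eq_lintegral_rpow_enorm_toReal (by norm_num) (by norm_num)]
          rw [← ENNReal.rpow_natCast, ← ENNReal.rpow_mul]
          norm_num
  have h3 := h1.trans h2
  rw [enorm_pow] at h3
  have h4 := ENNReal.toReal_mono (by finiteness) h3
  rw [ENNReal.toReal_mul, ENNReal.toReal_pow, ENNReal.toReal_pow, toReal_enorm, toReal_enorm]
    at h4
  have h5 : 0 < Real.sqrt v.toReal := Real.sqrt_pos.2 hvr
  rw [inv_mul_eq_div, le_div_iff₀ h5]
  refine le_of_sq_le_sq ?_ (norm_nonneg _)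
  rw [mul_pow, Real.sq_sqrt hvr.le]
  exact h4

/-- The Bergman space is closed in `L²(D)`, so that the orthogonal projection exists. -/
theorem isClosed_bergmanSpace {n : ℕ} (D : Opens (Fin n → ℂ)) :
    IsClosed (bergmanSpace D : Set (Lp ℂ 2 (volume.restrict (D : Set (Fin n → ℂ))))) := by
  rw [← isSeqClosed_iff_isClosed]
  intro F f hF hlim
  choose g hg hFg using hF
  have hcau := Metric.cauchySeq_iff.1 hlim.cauchySeq
  have hsub : ∀ k l, (F k - F l : Lp ℂ 2 (volume.restrict (D : Set (Fin n → ℂ))))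
      =ᵐ[volume.restrict (D : Set (Fin n → ℂ))] g k - g l := fun k l =>
    (Lp.coeFn_sub _ _).trans ((hFg k).sub (hFg l))
  have hloc : ∀ x ∈ D, ∃ r > 0, Metric.ball x r ⊆ D ∧
      UniformCauchySeqOn g atTop (Metric.ball x r) ∧
      UniformCauchySeqOn (fun k => fderiv ℂ (g k)) atTop (Metric.ball x r) := by
    intro x hx
    obtain ⟨ε, hε, hball⟩ := Metric.isOpen_iff.1 D.isOpen x hx
    obtain ⟨C, hC, hbd⟩ := norm_le_of_mem (D := D) (r := ε / 3) (by positivity)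
    have hb : ∀ k l, ∀ y ∈ Metric.ball x (2 * ε / 3), ‖g k y - g l y‖ ≤ C * ‖F k - F l‖ := by
      intro k l y hy
      refine hbd _ _ ((hg k).sub (hg l)) (hsub k l) y ?_
      refine (Metric.ball_subset_ball' ?_).trans hball
      rw [Metric.mem_ball] at hy
      linarith
    have hb' : ∀ k l, ∀ y ∈ Metric.ball x (ε / 3),
        ‖fderiv ℂ (g k) y - fderiv ℂ (g l) y‖ ≤ 2 * (C * ‖F k - F l‖) / (ε / 3) := by
      intro k l y hy
      have hyb : Metric.ball y (ε / 3) ⊆ Metric.ball x (2 * ε / 3) := by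
        refine Metric.ball_subset_ball' ?_
        rw [Metric.mem_ball] at hy
        linarith
      have hyD : Metric.ball y (ε / 3) ⊆ D :=
        hyb.trans ((Metric.ball_subset_ball (by linarith)).trans hball)
      have hyy : y ∈ Metric.ball y (ε / 3) := Metric.mem_ball_self (by positivity)
      have hd : ∀ m, DifferentiableAt ℂ (g m) y := fun m =>
        (hg m y (hyD hyy)).differentiableAt (D.isOpen.mem_nhds (hyD hyy))
      rw [← fderiv_sub (hd k) (hd l)]
      refine Complex.norm_fderiv_le_div_of_mapsTo_ball
        (((hg k).sub (hg l)).mono hyD) ?_ (by positivity)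
      intro w hw
      rw [mem_closedBall_iff_norm]
      refine (norm_sub_le _ _).trans ?_
      have e1 := hb k l w (hyb hw)
      have e2 := hb k l y (hyb hyy)
      simp only [Pi.sub_apply]
      linarith
    refine ⟨ε / 3, by positivity, (Metric.ball_subset_ball (by linarith)).trans hball, ?_, ?_⟩
    · rw [Metric.uniformCauchySeqOn_iff]
      intro η hη
      obtain ⟨N, hN⟩ := hcau (η / (C + 1)) (by positivity)
      refine ⟨N, fun k hk l hl y hy => ?_⟩
      have e1 := hb k l y (Metric.ball_subset_ball (by linarith) hy)
      have e2 := hN k hk l hl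
      rw [dist_eq_norm] at e2 ⊢
      rw [lt_div_iff₀ (by positivity)] at e2
      nlinarith [norm_nonneg (F k - F l)]
    · rw [Metric.uniformCauchySeqOn_iff]
      intro η hη
      obtain ⟨N, hN⟩ := hcau (η * (ε / 3) / (2 * C + 1)) (by positivity)
      refine ⟨N, fun k hk l hl y hy => ?_⟩
      have e1 := hb' k l y hy
      have e2 := hN k hk l hl
      rw [dist_eq_norm] at e2 ⊢
      rw [lt_div_iff₀ (by positivity)] at e2
      refine e1.trans_lt ?_
      rw [div_lt_iff₀ (by positivity)]
      rcases (norm_nonneg (F k - F l)).eq_or_lt with h0 | h0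
      · rw [← h0]; simp; positivity
      · nlinarith
  have hpt : ∀ x ∈ D, ∃ y, Tendsto (fun k => g k x) atTop (𝓝 y) := by
    intro x hx
    obtain ⟨r, hr, -, h1, -⟩ := hloc x hx
    exact cauchySeq_tendsto_of_complete (h1.cauchySeq (Metric.mem_ball_self hr))
  have hpt' : ∀ x ∈ D, ∃ y, Tendsto (fun k => fderiv ℂ (g k) x) atTop (𝓝 y) := by
    intro x hx
    obtain ⟨r, hr, -, -, h1⟩ := hloc x hx
    exact cauchySeq_tendsto_of_complete (h1.cauchySeq (Metric.mem_ball_self hr))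
  choose! G hG using hpt
  choose! G' hG' using hpt'
  refine ⟨G, fun x hx => ?_, ?_⟩
  · obtain ⟨r, hr, hrD, -, h2⟩ := hloc x hx
    have h3 := h2.tendstoUniformlyOn_of_tendsto fun y hy => hG' y (hrD hy)
    refine (hasFDerivAt_of_tendstoUniformlyOn Metric.isOpen_ball h3 (fun k y hy => ?_)
      (fun y hy => hG y (hrD hy))
      (Metric.mem_ball_self hr)).differentiableAt.differentiableWithinAt
    exact ((hg k y (hrD hy)).differentiableAt (D.isOpen.mem_nhds (hrD hy))).hasFDerivAt
  · obtain ⟨ns, hns, hae⟩ := (tendstoInMeasure_of_tendsto_Lp hlim).exists_seq_tendsto_ae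
    filter_upwards [hae, ae_all_iff.2 hFg, ae_restrict_mem D.isOpen.measurableSet]
      with x hx hgx hxD
    refine tendsto_nhds_unique hx ?_
    simp only [hgx]
    exact (hG x hxD).comp hns.tendsto_atTop

instance {n : ℕ} (D : Opens (Fin n → ℂ)) : (bergmanSpace D).HasOrthogonalProjection :=
  haveI := (isClosed_bergmanSpace D).completeSpace_coe
  inferInstance

/-- The Bergman projection `B_D`: the orthogonal projection of `L²(D)` with range `A²(D)`. -/
noncomputable def bergmanProjection {n : ℕ} (D : Opens (Fin n → ℂ)) :
    Lp ℂ 2 (volume.restrict (D : Set (Fin n → ℂ))) →L[ℂ]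
      Lp ℂ 2 (volume.restrict (D : Set (Fin n → ℂ))) :=
  (bergmanSpace D).starProjection

end Bergman

/-! The obstruction is a logarithm: a holomorphic function that is unbounded at a boundary point,
yet pairs boundedly with integrable holomorphic functions. Let `p` be a point of the closure of `D`
farthest from the origin and `l z = ⟨z, p⟩ / |p|²`. Then `Re (1 - l)` dominates `c ‖z - p‖²` on `D`,
so `g_δ = log (1 - l + δ)` is holomorphic on `D`, and bounded there for each `δ > 0`.

The heart is the estimate `|∫_D f conj g_δ| ≤ M ‖f‖₁` for integrable holomorphic `f`, with `M`
independent of `δ` (`exists_norm_integral_mul_conj_log_le`). Let `σ` be minus the defining function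
and `a ≠ 0` the value at `p` of its Cauchy–Riemann derivative along `p`. Replacing `a` by that
derivative, cut off near `p`, costs a factor `O(‖z - p‖)`, which absorbs the logarithm. The
remaining integral is integrated by parts: `σ` vanishes on the boundary, `f` is annihilated by the
Cauchy–Riemann operator, and differentiating `conj g_δ` gives `2 / |1 - l + δ|`, which is
compensated by `σ ≤ C Re (1 - l)`.

Suppose `B_D` had `L¹` bound `C`. Since `g_δ` lies in `A²(D)`, orthogonality gives `|∫_Q g_δ| = |∫_D
B_D(1_Q) conj g_δ| ≤ M C |Q|` for every ball `Q` in `D`. Small balls then force `|g_δ| ≤ M C + 1`,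
while `|g_δ(z)|` is unbounded as `z → p` and `δ → 0`. -/

namespace Bergman

open MeasureTheory TopologicalSpace Filter Topology
open scoped ContDiff

/-! ### Real `C¹` regularity of holomorphic functions -/

/-- A holomorphic function of several variables has a continuous derivative. -/
theorem continuousOn_fderiv_of_differentiableOn {n : ℕ} {f : (Fin n → ℂ) → ℂ}
    {D : Set (Fin n → ℂ)} (hD : IsOpen D) (hf : DifferentiableOn ℂ f D) :
    ContinuousOn (fderiv ℂ f) D := by
  intro x hx
  refine ContinuousAt.continuousWithinAt ?_
  obtain ⟨ε, hε, hball⟩ := Metric.isOpen_iff.1 hD x hx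
  set r := ε / 3 with hr
  have hr0 : 0 < r := by positivity
  have hsub : Metric.closedBall x (2 * r) ⊆ D :=
    (Metric.closedBall_subset_ball (by linarith)).trans hball
  have huc := (isCompact_closedBall x (2 * r)).uniformContinuousOn_of_continuous
    (hf.continuousOn.mono hsub)
  rw [Metric.uniformContinuousOn_iff] at huc
  rw [Metric.continuousAt_iff]
  intro η hη
  obtain ⟨δ, hδ, hδ'⟩ := huc (η * r / 4) (by positivity)
  refine ⟨min δ r, lt_min hδ hr0, fun y hy => ?_⟩
  have hyδ : ‖y - x‖ < δ := by
    rw [← dist_eq_norm]; exact hy.trans_le (min_le_left _ _)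
  have hyr : ‖y - x‖ < r := by
    rw [← dist_eq_norm]; exact hy.trans_le (min_le_right _ _)
  have hmem : ∀ w ∈ Metric.ball x r, w ∈ Metric.closedBall x (2 * r) ∧
      w + (y - x) ∈ Metric.closedBall x (2 * r) := by
    intro w hw
    rw [Metric.mem_ball, dist_eq_norm] at hw
    rw [Metric.mem_closedBall, Metric.mem_closedBall, dist_eq_norm, dist_eq_norm]
    refine ⟨by linarith, ?_⟩
    have : w + (y - x) - x = (w - x) + (y - x) := by abel
    rw [this]
    exact (norm_add_le _ _).trans (by linarith)
  have hsmall : ∀ w ∈ Metric.ball x r, ‖f (w + (y - x)) - f w‖ < η * r / 4 := by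
    intro w hw
    rw [← dist_eq_norm]
    exact hδ' _ (hmem w hw).2 _ (hmem w hw).1 (by simpa [dist_eq_norm] using hyδ)
  have hxr : x ∈ Metric.ball x r := Metric.mem_ball_self hr0
  have hdiff : DifferentiableOn ℂ (fun w => f (w + (y - x)) - f w) (Metric.ball x r) := by
    refine DifferentiableOn.sub ?_ (hf.mono fun w hw => hsub (hmem w hw).1)
    exact hf.comp (f := fun w => w + (y - x)) (by fun_prop) fun w hw => hsub (hmem w hw).2
  -- Cauchy estimate for the difference of `f` and its translate: uniform continuity makes the
  -- difference small on a ball of fixed radius `r`, hence its derivative at `x` is at most `η / 2`.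
  have hest := Complex.norm_fderiv_le_div_of_mapsTo_ball hdiff (R₂ := η * r / 2) (by
    intro w hw
    rw [mem_closedBall_iff_norm]
    refine (norm_sub_le _ _).trans ?_
    have := hsmall w hw
    have := hsmall x hxr
    linarith) hr0
  have hxD : DifferentiableAt ℂ f x := (hf x hx).differentiableAt (hD.mem_nhds hx)
  have hyD : DifferentiableAt ℂ f (x + (y - x)) :=
    (hf.differentiableAt (hD.mem_nhds (hsub (hmem x hxr).2)))
  have heq : fderiv ℂ (fun w => f (w + (y - x)) - f w) x = fderiv ℂ f y - fderiv ℂ f x := by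
    have hcomp : DifferentiableAt ℂ (fun w => f (w + (y - x))) x :=
      DifferentiableAt.comp (g := f) (f := fun w => w + (y - x)) x hyD (by fun_prop)
    rw [fderiv_fun_sub hcomp hxD, fderiv_comp_add_right]
    simp
  rw [heq] at hest
  rw [dist_eq_norm]
  refine hest.trans_lt ?_
  rw [div_lt_iff₀ hr0]
  nlinarith [mul_pos hη hr0]

theorem contDiffOn_one_of_differentiableOn {n : ℕ} {f : (Fin n → ℂ) → ℂ}
    {D : Set (Fin n → ℂ)} (hD : IsOpen D) (hf : DifferentiableOn ℂ f D) :
    ContDiffOn ℝ 1 f D := by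
  have : ContDiffOn ℂ 1 f D := by
    rw [show (1 : WithTop ℕ∞) = 0 + 1 by simp, contDiffOn_succ_iff_fderiv_of_isOpen hD]
    exact ⟨hf, by simp, contDiffOn_zero.2 (continuousOn_fderiv_of_differentiableOn hD hf)⟩
  exact this.restrict_scalars ℝ

/-! ### Smooth truncations of the identity -/

/-- The square of the positive part is continuously differentiable. -/
theorem hasDerivAt_max_zero_sq (x : ℝ) :
    HasDerivAt (fun y : ℝ => (max y 0) ^ 2) (2 * max x 0) x := by
  rcases lt_trichotomy x 0 with hx | rfl | hx
  · rw [max_eq_right hx.le, mul_zero]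
    refine (hasDerivAt_const x (0 : ℝ)).congr_of_eventuallyEq ?_
    filter_upwards [eventually_lt_nhds hx] with y hy
    simp [max_eq_right hy.le]
  · rw [hasDerivAt_iff_isLittleO]
    simp only [max_self, sub_zero, mul_zero, smul_zero]
    refine Asymptotics.IsBigO.trans_isLittleO (g := fun y : ℝ => y ^ 2) ?_ ?_
    · refine Asymptotics.IsBigO.of_bound 1 (Eventually.of_forall fun y => ?_)
      rw [one_mul, zero_pow two_ne_zero, sub_zero, Real.norm_of_nonneg (sq_nonneg _),
        Real.norm_of_nonneg (sq_nonneg _)]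
      rcases le_total y 0 with h | h
      · rw [max_eq_right h, zero_pow two_ne_zero]
        exact sq_nonneg y
      · rw [max_eq_left h]
    · simpa using Asymptotics.isLittleO_pow_id (𝕜 := ℝ) (n := 2) (by norm_num)
  · rw [max_eq_left hx.le]
    have h := hasDerivAt_pow 2 x
    simp only [Nat.cast_ofNat, Nat.add_one_sub_one, pow_one] at h
    refine h.congr_of_eventuallyEq ?_
    filter_upwards [eventually_gt_nhds hx] with y hy
    simp [max_eq_left hy.le]

theorem contDiff_max_zero_sq : ContDiff ℝ 1 (fun y : ℝ => (max y 0) ^ 2) := by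
  rw [contDiff_one_iff_deriv]
  refine ⟨fun x => (hasDerivAt_max_zero_sq x).differentiableAt, ?_⟩
  have : deriv (fun y : ℝ => (max y 0) ^ 2) = fun x => 2 * max x 0 :=
    funext fun x => (hasDerivAt_max_zero_sq x).deriv
  rw [this]
  fun_prop

/-- A `C¹` approximation of the identity of `(0, ∞)` that vanishes on `(0, ε]`. -/
noncomputable def truncId (ε u : ℝ) : ℝ := (max (u - ε) 0) ^ 2 / u

/-- The derivative of `truncId`. -/
noncomputable def truncIdDeriv (ε u : ℝ) : ℝ :=
  max (u - ε) 0 * (2 * u - max (u - ε) 0) / u ^ 2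

theorem hasDerivAt_truncId {ε u : ℝ} (hu : u ≠ 0) :
    HasDerivAt (truncId ε) (truncIdDeriv ε u) u := by
  have h := ((hasDerivAt_max_zero_sq (u - ε)).comp_sub_const u ε).fun_div (hasDerivAt_id u) hu
  convert! h using 1
  simp only [truncIdDeriv, id]
  ring

theorem contDiffOn_truncId (ε : ℝ) : ContDiffOn ℝ 1 (truncId ε) (Set.Ioi 0) := by
  refine ContDiffOn.div ?_ contDiffOn_id fun x hx => (Set.mem_Ioi.1 hx).ne'
  exact (contDiff_max_zero_sq.comp (contDiff_id.sub contDiff_const)).contDiffOn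

theorem truncId_eq_zero {ε u : ℝ} (h : u ≤ ε) : truncId ε u = 0 := by
  simp [truncId, max_eq_right (sub_nonpos.2 h)]

theorem abs_truncId_le {ε u : ℝ} (hε : 0 ≤ ε) (hu : 0 < u) : |truncId ε u| ≤ u := by
  have h0 : 0 ≤ max (u - ε) 0 := le_max_right _ _
  have h1 : max (u - ε) 0 ≤ u := max_le (by linarith) hu.le
  rw [truncId, abs_of_nonneg (by positivity), div_le_iff₀ hu]
  nlinarith

/-- With `m = max (u - ε) 0`, the derivative equals `1 - (1 - m / u)²` and `0 ≤ m ≤ u`. The bound is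
uniform in `ε`, as dominated convergence requires. -/
theorem abs_truncIdDeriv_le {ε u : ℝ} (hε : 0 ≤ ε) (hu : 0 < u) : |truncIdDeriv ε u| ≤ 1 := by
  have h0 : 0 ≤ max (u - ε) 0 := le_max_right _ _
  have h1 : max (u - ε) 0 ≤ u := max_le (by linarith) hu.le
  rw [truncIdDeriv, abs_of_nonneg (div_nonneg (mul_nonneg h0 (by linarith)) (by positivity)),
    div_le_one (by positivity)]
  nlinarith [sq_nonneg (u - max (u - ε) 0)]

theorem tendsto_truncId {u : ℝ} (hu : 0 < u) :
    Tendsto (fun ε => truncId ε u) (𝓝 0) (𝓝 u) := by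
  have : Continuous (fun ε => truncId ε u) := by unfold truncId; fun_prop
  convert! this.tendsto 0 using 2
  simp only [truncId, sub_zero, max_eq_left hu.le]
  field_simp

theorem tendsto_truncIdDeriv {u : ℝ} (hu : 0 < u) :
    Tendsto (fun ε => truncIdDeriv ε u) (𝓝 0) (𝓝 1) := by
  have : Continuous (fun ε => truncIdDeriv ε u) := by unfold truncIdDeriv; fun_prop
  convert! this.tendsto 0 using 2
  simp only [truncIdDeriv, sub_zero, max_eq_left hu.le]
  field_simp
  ring

/-! ### The Cauchy–Riemann operator and integration by parts -/

/-- Twice the Cauchy–Riemann operator along the complex line spanned by `v`. -/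
noncomputable def dbar {n : ℕ} (v : Fin n → ℂ) (F : (Fin n → ℂ) → ℂ) (x : Fin n → ℂ) : ℂ :=
  fderiv ℝ F x v + Complex.I * fderiv ℝ F x (Complex.I • v)

theorem dbar_mul {n : ℕ} {v x : Fin n → ℂ} {F G : (Fin n → ℂ) → ℂ}
    (hF : DifferentiableAt ℝ F x) (hG : DifferentiableAt ℝ G x) :
    dbar v (fun y => F y * G y) x = dbar v F x * G x + F x * dbar v G x := by
  simp only [dbar, fderiv_fun_mul hF hG]
  simp
  ring

theorem dbar_eq_zero {n : ℕ} {v x : Fin n → ℂ} {F : (Fin n → ℂ) → ℂ}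
    (hF : DifferentiableAt ℂ F x) : dbar v F x = 0 := by
  rw [dbar, hF.fderiv_restrictScalars ℝ]
  simp only [ContinuousLinearMap.coe_restrictScalars', map_smul, smul_eq_mul]
  rw [← mul_assoc, Complex.I_mul_I]
  ring

/-- The derivative of `conj F` is conjugate-linear, so the two terms of `dbar` add up instead of
cancelling as they do for `F`. -/
theorem dbar_conj {n : ℕ} {v x : Fin n → ℂ} {F : (Fin n → ℂ) → ℂ}
    (hF : DifferentiableAt ℂ F x) :
    dbar v (fun y => starRingEnd ℂ (F y)) x = 2 * starRingEnd ℂ (fderiv ℂ F x v) := by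
  have h : HasFDerivAt (fun y => starRingEnd ℂ (F y))
      (Complex.conjCLE.toContinuousLinearMap.comp ((fderiv ℂ F x).restrictScalars ℝ)) x :=
    (Complex.conjCLE.toContinuousLinearMap.hasFDerivAt (x := F x)).comp x
      (hF.hasFDerivAt.restrictScalars ℝ)
  rw [dbar, h.fderiv]
  simp only [ContinuousLinearMap.comp_apply, ContinuousLinearMap.coe_restrictScalars', map_smul,
    smul_eq_mul, ContinuousLinearEquiv.coe_coe, Complex.conjCLE_apply, map_mul, Complex.conj_I]
  rw [← mul_assoc, mul_neg, Complex.I_mul_I]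
  ring

theorem dbar_comp_ofReal {n : ℕ} {v x : Fin n → ℂ} {σ : (Fin n → ℂ) → ℝ} {m : ℝ → ℝ} {m' : ℝ}
    (hσ : DifferentiableAt ℝ σ x) (hm : HasDerivAt m m' (σ x)) :
    dbar v (fun y => (m (σ y) : ℂ)) x = m' * dbar v (fun y => (σ y : ℂ)) x := by
  have h1 : HasFDerivAt (fun y => (σ y : ℂ)) (Complex.ofRealCLM.comp (fderiv ℝ σ x)) x :=
    Complex.ofRealCLM.hasFDerivAt.comp x hσ.hasFDerivAt
  have h2 : HasFDerivAt (fun y => (m (σ y) : ℂ))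
      (Complex.ofRealCLM.comp (m' • fderiv ℝ σ x)) x :=
    Complex.ofRealCLM.hasFDerivAt.comp x (hm.comp_hasFDerivAt x hσ.hasFDerivAt)
  rw [dbar, dbar, h1.fderiv, h2.fderiv]
  simp
  ring

theorem dbar_congr {n : ℕ} {v x : Fin n → ℂ} {F G : (Fin n → ℂ) → ℂ} (h : F =ᶠ[𝓝 x] G) :
    dbar v F x = dbar v G x := by
  rw [dbar, dbar, h.fderiv_eq]

theorem norm_dbar_le {n : ℕ} (v x : Fin n → ℂ) (F : (Fin n → ℂ) → ℂ) :
    ‖dbar v F x‖ ≤ 2 * (‖fderiv ℝ F x‖ * ‖v‖) := by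
  have h1 := (fderiv ℝ F x).le_opNorm v
  have h2 := (fderiv ℝ F x).le_opNorm (Complex.I • v)
  rw [norm_smul, Complex.norm_I, one_mul] at h2
  refine (norm_add_le _ _).trans ?_
  rw [norm_mul, Complex.norm_I, one_mul]
  linarith

theorem continuousOn_dbar {n : ℕ} {v : Fin n → ℂ} {F : (Fin n → ℂ) → ℂ} {U : Set (Fin n → ℂ)}
    (hU : IsOpen U) (hF : ContDiffOn ℝ 1 F U) : ContinuousOn (dbar v F) U := by
  have h := hF.continuousOn_fderiv_of_isOpen hU le_rfl
  exact (h.clm_apply continuousOn_const).add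
    (continuousOn_const.mul (h.clm_apply continuousOn_const))

theorem integral_fderiv_apply_eq_zero {n : ℕ} {F : (Fin n → ℂ) → ℂ} (hF : ContDiff ℝ 1 F)
    (hc : HasCompactSupport F) (v : Fin n → ℂ) : ∫ x, fderiv ℝ F x v = 0 := by
  have hcont : Continuous (fun x => fderiv ℝ F x v) :=
    (hF.continuous_fderiv one_ne_zero).clm_apply continuous_const
  have hint : Integrable (fun x => fderiv ℝ F x v) :=
    hcont.integrable_of_hasCompactSupport (hc.fderiv_apply ℝ v)
  have h := integral_mul_fderiv_eq_neg_fderiv_mul_of_integrable (μ := volume)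
    (f := fun _ : Fin n → ℂ => (1 : ℂ)) (g := F) (v := v) (by simp) (by simpa using hint)
    (by simpa using hF.continuous.integrable_of_hasCompactSupport hc)
    (fun x _ => differentiableAt_const _) (fun x _ => (hF.differentiable one_ne_zero x))
  simpa using h

theorem integral_dbar_eq_zero {n : ℕ} {F : (Fin n → ℂ) → ℂ} (hF : ContDiff ℝ 1 F)
    (hc : HasCompactSupport F) (v : Fin n → ℂ) : ∫ x, dbar v F x = 0 := by
  have hint : ∀ w, Integrable (fun x => fderiv ℝ F x w) := fun w =>
    ((hF.continuous_fderiv one_ne_zero).clm_apply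
      continuous_const).integrable_of_hasCompactSupport (hc.fderiv_apply ℝ w)
  simp only [dbar]
  rw [integral_add (hint _) ((hint _).const_mul _), integral_const_mul,
    integral_fderiv_apply_eq_zero hF hc, integral_fderiv_apply_eq_zero hF hc]
  simp

/-- The extension of `F` by zero is `C¹` on the whole space, because it vanishes off a compact
subset of `U`. -/
theorem setIntegral_dbar_eq_zero {n : ℕ} {F : (Fin n → ℂ) → ℂ} {U K : Set (Fin n → ℂ)}
    (hU : IsOpen U) (hK : IsCompact K) (hKU : K ⊆ U) (hF : ContDiffOn ℝ 1 F U)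
    (h0 : ∀ x ∈ U, x ∉ K → F x = 0) (v : Fin n → ℂ) : ∫ x in U, dbar v F x = 0 := by
  have hout : ∀ x ∉ K, U.indicator F x = 0 := by
    intro x hx
    by_cases hxU : x ∈ U
    · rw [Set.indicator_of_mem hxU, h0 x hxU hx]
    · exact Set.indicator_of_notMem hxU _
  have hev : ∀ x ∈ U, U.indicator F =ᶠ[𝓝 x] F := fun x hx =>
    Set.eqOn_indicator.eventuallyEq_of_mem (hU.mem_nhds hx)
  have hev0 : ∀ x ∉ K, U.indicator F =ᶠ[𝓝 x] fun _ => 0 := fun x hx => by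
    filter_upwards [hK.isClosed.isOpen_compl.mem_nhds hx] with y hy
    exact hout y hy
  have hsm : ContDiff ℝ 1 (U.indicator F) := by
    rw [contDiff_iff_contDiffAt]
    intro x
    by_cases hx : x ∈ U
    · exact (hF.contDiffAt (hU.mem_nhds hx)).congr_of_eventuallyEq (hev x hx)
    · exact contDiffAt_const.congr_of_eventuallyEq (hev0 x fun h => hx (hKU h))
  rw [← integral_dbar_eq_zero hsm (HasCompactSupport.intro hK hout) v,
    ← integral_indicator hU.measurableSet]
  congr 1 with x
  by_cases hx : x ∈ U
  · rw [Set.indicator_of_mem hx, dbar_congr (hev x hx)]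
  · rw [Set.indicator_of_notMem hx, dbar_congr (hev0 x fun h => hx (hKU h))]
    simp [dbar]

/-- Integration by parts against a weight `σ` that vanishes on the part of the boundary of `U` met
by the support of `G`: no boundary term appears. -/
theorem setIntegral_dbar_weight_mul {n : ℕ} {G : (Fin n → ℂ) → ℂ} {σ : (Fin n → ℂ) → ℝ}
    {U : Set (Fin n → ℂ)} (hU : IsOpen U) (hσ : ContDiffOn ℝ 1 σ U) (hpos : ∀ x ∈ U, 0 < σ x)
    (hG : ContDiffOn ℝ 1 G U)
    (hcpt : ∀ ε > 0, ∃ K, IsCompact K ∧ K ⊆ U ∧ ∀ x ∈ U, ε ≤ σ x → x ∉ K → G x = 0)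
    (v : Fin n → ℂ) (hi₁ : IntegrableOn (fun x => dbar v (fun y => (σ y : ℂ)) x * G x) U)
    (hi₂ : IntegrableOn (fun x => (σ x : ℂ) * dbar v G x) U) :
    ∫ x in U, dbar v (fun y => (σ y : ℂ)) x * G x = - ∫ x in U, (σ x : ℂ) * dbar v G x := by
  -- Replacing `σ` by `truncId ε σ`, which vanishes where `σ ≤ ε`, makes the product with `G` vanish
  -- off a compact subset of `U`; then `ε → 0`.
  have htr : ∀ ε, ContDiffOn ℝ 1 (fun x => (truncId ε (σ x) : ℂ)) U := fun ε =>
    Complex.ofRealCLM.contDiff.comp_contDiffOn ((contDiffOn_truncId ε).comp hσ hpos)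
  have hprod : ∀ ε, ContDiffOn ℝ 1 (fun x => (truncId ε (σ x) : ℂ) * G x) U := fun ε =>
    (htr ε).mul hG
  have hformula : ∀ ε, ∀ x ∈ U, dbar v (fun x => (truncId ε (σ x) : ℂ) * G x) x =
      truncIdDeriv ε (σ x) * (dbar v (fun y => (σ y : ℂ)) x * G x) +
        truncId ε (σ x) * dbar v G x := by
    intro ε x hx
    have hn := hU.mem_nhds hx
    rw [dbar_mul ((htr ε).differentiableOn one_ne_zero |>.differentiableAt hn)
      (hG.differentiableOn one_ne_zero |>.differentiableAt hn),
      dbar_comp_ofReal (hσ.differentiableOn one_ne_zero |>.differentiableAt hn)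
      (hasDerivAt_truncId (hpos x hx).ne')]
    ring
  have hzero : ∀ ε > 0, ∫ x in U, dbar v (fun x => (truncId ε (σ x) : ℂ) * G x) x = 0 := by
    intro ε hε
    obtain ⟨K, hK, hKU, hKG⟩ := hcpt ε hε
    refine setIntegral_dbar_eq_zero hU hK hKU (hprod ε) (fun x hx hxK => ?_) v
    rcases le_total ε (σ x) with h | h
    · rw [hKG x hx h hxK, mul_zero]
    · rw [truncId_eq_zero h, Complex.ofReal_zero, zero_mul]
  have hlim : Tendsto (fun k : ℕ => ∫ x in U,
      dbar v (fun x => (truncId (1 / ((k : ℝ) + 1)) (σ x) : ℂ) * G x) x) atTop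
      (𝓝 (∫ x in U, (dbar v (fun y => (σ y : ℂ)) x * G x + (σ x : ℂ) * dbar v G x))) := by
    refine tendsto_integral_of_dominated_convergence
      (fun x => ‖dbar v (fun y => (σ y : ℂ)) x * G x‖ + ‖(σ x : ℂ) * dbar v G x‖)
      (fun k => (continuousOn_dbar hU (hprod _)).aestronglyMeasurable hU.measurableSet)
      (hi₁.norm.add hi₂.norm) (fun k => ?_) ?_
    · filter_upwards [ae_restrict_mem hU.measurableSet] with x hx
      have hε : (0 : ℝ) ≤ 1 / ((k : ℝ) + 1) := by positivity
      rw [hformula _ x hx]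
      refine (norm_add_le _ _).trans (add_le_add ?_ ?_)
      · rw [norm_mul, Complex.norm_real]
        exact mul_le_of_le_one_left (norm_nonneg _) (abs_truncIdDeriv_le hε (hpos x hx))
      · rw [norm_mul, norm_mul, Complex.norm_real, Complex.norm_real,
          Real.norm_of_nonneg (hpos x hx).le]
        exact mul_le_mul_of_nonneg_right (abs_truncId_le hε (hpos x hx)) (norm_nonneg _)
    · filter_upwards [ae_restrict_mem hU.measurableSet] with x hx
      simp only [hformula _ x hx]
      have h0 := tendsto_one_div_add_atTop_nhds_zero_nat (𝕜 := ℝ)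
      have h1 := (Complex.continuous_ofReal.tendsto _).comp
        ((tendsto_truncIdDeriv (hpos x hx)).comp h0)
      have h2 := (Complex.continuous_ofReal.tendsto _).comp
        ((tendsto_truncId (hpos x hx)).comp h0)
      have h3 := (h1.mul_const (dbar v (fun y => (σ y : ℂ)) x * G x)).add
        (h2.mul_const (dbar v G x))
      simpa using h3
  have h : ∫ x in U, (dbar v (fun y => (σ y : ℂ)) x * G x + (σ x : ℂ) * dbar v G x) = 0 := by
    refine tendsto_nhds_unique hlim ?_
    simp only [hzero _ (Nat.one_div_pos_of_nat)]
    exact tendsto_const_nhds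
  rw [integral_add hi₁ hi₂] at h
  exact eq_neg_of_add_eq_zero_left h

/-! ### Geometry at a farthest boundary point -/

/-- A nonempty bounded open set of `ℂⁿ` has a boundary point (one farthest from the origin) that
is strictly supported by a complex linear functional, with quadratic contact. -/
theorem exists_supporting_functional {n : ℕ} (hn : 1 ≤ n) {D : Set (Fin n → ℂ)} (hD : IsOpen D)
    (hne : D.Nonempty) (hb : Bornology.IsBounded D) :
    ∃ p ∈ frontier D, ∃ l : (Fin n → ℂ) →L[ℂ] ℂ, ∃ c > 0, l p = 1 ∧
      ∀ z ∈ D, c * ‖z - p‖ ^ 2 ≤ (1 - l z).re := by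
  -- The norm of `Fin n → ℂ` is the sup norm; the argument needs the Euclidean one, whose square is
  -- `N`.
  set N : (Fin n → ℂ) → ℝ := fun z => ∑ i, ‖z i‖ ^ 2 with hN
  have hNc : Continuous N := by fun_prop
  have hN0 : ∀ z, 0 ≤ N z := fun z => Finset.sum_nonneg fun i _ => by positivity
  have hincr : ∀ z ∈ D, ∃ z' ∈ D, N z < N z' := by
    intro z hz
    obtain ⟨ε, hε, hball⟩ := Metric.isOpen_iff.1 hD z hz
    set w : Fin n → ℂ := fun _ => ((ε / 2 : ℝ) : ℂ) with hw
    have hwn : ‖w‖ < ε := by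
      refine (pi_norm_lt_iff hε).2 fun i => ?_
      rw [hw, Complex.norm_real, Real.norm_of_nonneg (by positivity)]
      linarith
    have hpar : N (z + w) + N (z - w) = 2 * N z + 2 * N w := by
      simp only [hN, Finset.mul_sum, ← Finset.sum_add_distrib]
      refine Finset.sum_congr rfl fun i _ => ?_
      have := parallelogram_law_with_norm ℝ (z i) (w i)
      simp only [Pi.add_apply, Pi.sub_apply]
      linarith
    have hNw : 0 < N w := by
      have : Nonempty (Fin n) := ⟨⟨0, hn⟩⟩
      refine Finset.sum_pos (fun i _ => ?_) Finset.univ_nonempty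
      rw [hw, Complex.norm_real, Real.norm_of_nonneg (by positivity)]
      positivity
    by_contra! hcon
    have h1 := hcon (z + w) (hball (by simpa using hwn))
    have h2 := hcon (z - w) (hball (by simpa [dist_eq_norm] using hwn))
    linarith
  obtain ⟨p, hp, hmax⟩ := hb.isCompact_closure.exists_isMaxOn hne.closure hNc.continuousOn
  have hmax' : ∀ z ∈ D, N z ≤ N p := fun z hz => hmax (subset_closure hz)
  have hpD : p ∉ D := fun h => by
    obtain ⟨z', hz', hlt⟩ := hincr p h
    exact absurd (hmax' z' hz') (not_le.2 hlt)
  have hNp : 0 < N p := by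
    obtain ⟨z, hz⟩ := hne
    obtain ⟨z', hz', hlt⟩ := hincr z hz
    exact (hN0 z).trans_lt (hlt.trans_le (hmax' z' hz'))
  set l : (Fin n → ℂ) →L[ℂ] ℂ :=
    ∑ i, (starRingEnd ℂ (p i) / (N p : ℂ)) • ContinuousLinearMap.proj (R := ℂ) i with hl
  have hlz : ∀ z, l z = (∑ i, starRingEnd ℂ (p i) * z i) / (N p : ℂ) := by
    intro z
    rw [hl, Finset.sum_div]
    simp only [_root_.sum_apply, _root_.smul_apply,
      ContinuousLinearMap.proj_apply, smul_eq_mul]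
    exact Finset.sum_congr rfl fun i _ => by ring
  refine ⟨p, ⟨hp, by rwa [hD.interior_eq]⟩, l, 1 / (2 * N p), by positivity, ?_, fun z hz => ?_⟩
  · rw [hlz]
    have : ∑ i, starRingEnd ℂ (p i) * p i = (N p : ℂ) := by
      simp only [hN, Complex.ofReal_sum]
      refine Finset.sum_congr rfl fun i _ => ?_
      rw [Complex.conj_mul', Complex.ofReal_pow]
    rw [this, div_self (by exact_mod_cast hNp.ne')]
  -- Since `N z ≤ N p`, expanding the square gives `N (z - p) ≤ 2 N p · Re (1 - l z)`, whence the
  -- constant `1 / (2 N p)`.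
  · have hexp : N (z - p) = N z + N p - 2 * (∑ i, starRingEnd ℂ (p i) * z i).re := by
      simp only [hN, Complex.re_sum, Finset.mul_sum, ← Finset.sum_add_distrib,
        ← Finset.sum_sub_distrib]
      refine Finset.sum_congr rfl fun i _ => ?_
      rw [Pi.sub_apply, ← Complex.normSq_eq_norm_sq, ← Complex.normSq_eq_norm_sq,
        ← Complex.normSq_eq_norm_sq, Complex.normSq_sub, mul_comm (z i)]
    have hsup : ‖z - p‖ ^ 2 ≤ N (z - p) := by
      rw [← Real.sq_sqrt (hN0 (z - p))]
      gcongr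
      refine (pi_norm_le_iff_of_nonneg (Real.sqrt_nonneg _)).2 fun i => ?_
      refine Real.le_sqrt_of_sq_le ?_
      exact Finset.single_le_sum (f := fun i => ‖(z - p) i‖ ^ 2) (fun i _ => by positivity)
        (Finset.mem_univ i)
    rw [hlz, Complex.sub_re, Complex.div_ofReal_re, Complex.one_re]
    have h1 := hmax' z hz
    rw [one_div, inv_mul_le_iff₀ (by positivity)]
    have h2 : 2 * N p * (1 - (∑ i, starRingEnd ℂ (p i) * z i).re / N p) =
        2 * N p - 2 * (∑ i, starRingEnd ℂ (p i) * z i).re := by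
      field_simp
    rw [h2]
    linarith

/-- At a boundary point with a supporting functional, a defining function has a nonzero derivative
in every direction on which the functional takes the value `1`. -/
theorem fderiv_apply_ne_zero_of_supporting {n : ℕ} {D V : Set (Fin n → ℂ)}
    {ρ : (Fin n → ℂ) → ℝ} {p : Fin n → ℂ} {l : (Fin n → ℂ) →L[ℂ] ℂ} (hV : V ∈ 𝓝 p)
    (hρ : DifferentiableAt ℝ ρ p) (hρp : ρ p = 0) (hout : ∀ z ∈ V, z ∉ D → 0 ≤ ρ z)
    (hl : l p = 1) (hsupp : ∀ z ∈ D, 0 ≤ (1 - l z).re) (hne : fderiv ℝ ρ p ≠ 0) :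
    fderiv ℝ ρ p p ≠ 0 := by
  -- Moving from `p` along such `v` makes `Re (1 - l)` negative, hence leaves `D`, where `ρ ≥ 0 = ρ
  -- p`.
  have hnonneg : ∀ v, 0 < (l v).re → 0 ≤ fderiv ℝ ρ p v := by
    intro v hv
    have h := (hρ.hasFDerivAt.hasLineDerivAt v).tendsto_slope_zero_right
    refine ge_of_tendsto h ?_
    have hcont : Tendsto (fun t : ℝ => p + t • v) (𝓝[>] 0) (𝓝 p) := by
      have : Continuous (fun t : ℝ => p + t • v) := by fun_prop
      have := this.tendsto 0
      simp only [zero_smul, add_zero] at this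
      exact this.mono_left nhdsWithin_le_nhds
    filter_upwards [hcont hV, self_mem_nhdsWithin] with t ht ht0
    have ht0' : (0 : ℝ) < t := ht0
    rw [hρp, sub_zero, smul_eq_mul]
    refine mul_nonneg (inv_nonneg.2 ht0'.le) (hout _ ht fun hD => ?_)
    have := hsupp _ hD
    rw [map_add, hl, l.map_smul_of_tower t v] at this
    simp only [sub_add_cancel_left, Complex.neg_re, Complex.smul_re, smul_eq_mul] at this
    nlinarith
  intro h0
  refine hne (ContinuousLinearMap.ext fun w => ?_)
  -- If the derivative vanishes on `p`, adding `p` to a small multiple of `w` brings any `w` into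
  -- the half space of `hnonneg` at no cost.
  have key : ∀ w, 0 ≤ fderiv ℝ ρ p w := by
    intro w
    obtain ⟨t, ht, ht'⟩ : ∃ t : ℝ, 0 < t ∧ 0 < 1 + t * (l w).re := by
      refine ⟨1 / (1 + |(l w).re|), by positivity, ?_⟩
      have h1 : |1 / (1 + |(l w).re|) * (l w).re| < 1 := by
        rw [abs_mul, abs_of_pos (by positivity), one_div, inv_mul_lt_iff₀ (by positivity)]
        linarith
      linarith [(abs_lt.1 h1).1]
    have h2 := hnonneg (p + t • w) (by
      rw [map_add, hl, l.map_smul_of_tower t w]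
      simpa using ht')
    rw [map_add, h0, map_smul, zero_add, smul_eq_mul] at h2
    exact nonneg_of_mul_nonneg_right h2 ht
  have h1 := key w
  have h2 := key (-w)
  rw [map_neg] at h2
  simp only [_root_.zero_apply]
  linarith

theorem dbar_ofReal {n : ℕ} {v x : Fin n → ℂ} {σ : (Fin n → ℂ) → ℝ}
    (hσ : DifferentiableAt ℝ σ x) :
    dbar v (fun y => (σ y : ℂ)) x =
      (fderiv ℝ σ x v : ℂ) + Complex.I * (fderiv ℝ σ x (Complex.I • v) : ℂ) := by
  have h1 : HasFDerivAt (fun y => (σ y : ℂ)) (Complex.ofRealCLM.comp (fderiv ℝ σ x)) x :=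
    Complex.ofRealCLM.hasFDerivAt.comp x hσ.hasFDerivAt
  rw [dbar, h1.fderiv]
  simp

/-- The local data at a strictly supported smooth boundary point `p` of `D`: the supporting
functional `l`, and a function `σ`, positive on `D` near `p` and vanishing on the boundary, that is
controlled by the real part of `1 - l`, and whose `dbar`-derivative along `p` is close to
`a ≠ 0`. -/
structure IsSupportedAt {n : ℕ} (D : Set (Fin n → ℂ)) (p : Fin n → ℂ)
    (l : (Fin n → ℂ) →L[ℂ] ℂ) (σ : (Fin n → ℂ) → ℝ) (c r C : ℝ) (a : ℂ) : Prop where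
  c_pos : 0 < c
  r_pos : 0 < r
  C_nonneg : 0 ≤ C
  a_ne : a ≠ 0
  mem_closure : p ∈ closure D
  apply_eq_one : l p = 1
  contact : ∀ z ∈ D, c * ‖z - p‖ ^ 2 ≤ (1 - l z).re
  notMem : p ∉ D
  contDiffOn : ContDiffOn ℝ 1 σ (D ∩ Metric.ball p r)
  pos : ∀ z ∈ D ∩ Metric.ball p r, 0 < σ z
  le_re : ∀ z ∈ D ∩ Metric.ball p r, σ z ≤ C * (1 - l z).re
  norm_dbar_sub_le : ∀ z ∈ D ∩ Metric.ball p r,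
    ‖a - dbar p (fun y => (σ y : ℂ)) z‖ ≤ C * ‖z - p‖
  exists_compact : ∀ ε > 0, ∃ K, IsCompact K ∧ K ⊆ D ∩ Metric.ball p r ∧
    ∀ z ∈ D, ‖z - p‖ ≤ r / 2 → ε ≤ σ z → z ∈ K

/-- Here `σ = -ρ`. For `σ ≤ C Re (1 - l)`, translate `z` by `t p` with `t = Re (1 - l z)`: the new
point has `Re (1 - l) = 0`, so it lies outside `D`, where `ρ ≥ 0`, and the Lipschitz bound on `ρ`
gives `-ρ z ≤ K₁ t ‖p‖`. -/
theorem exists_isSupportedAt {n : ℕ} (hn : 1 ≤ n) {D : Set (Fin n → ℂ)} (hD : IsOpen D)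
    (hne : D.Nonempty) (hb : Bornology.IsBounded D) (hs : IsSmoothlyBounded D) :
    ∃ p l σ c r C a, IsSupportedAt D p l σ c r C a := by
  obtain ⟨p, hp, l, c, hc, hl, hcontact⟩ := exists_supporting_functional hn hD hne hb
  obtain ⟨V, ρ, hV, hDV, hρ, hdρ, hDρ⟩ := hs
  have hpD : p ∉ D := by
    have := hp.2
    rwa [hD.interior_eq] at this
  have hpV : V ∈ 𝓝 p := hV.mem_nhds (hDV hp)
  have hmem : ∀ z ∈ V, (z ∈ D ↔ ρ z < 0) := fun z hz => by
    have : z ∈ D ∩ V ↔ z ∈ {z ∈ V | ρ z < 0} := by rw [hDρ]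
    simpa [hz] using this
  have hout : ∀ z ∈ V, z ∉ D → 0 ≤ ρ z := fun z hz hzD => by
    by_contra! h
    exact hzD ((hmem z hz).2 h)
  have hρat : ContDiffAt ℝ ∞ ρ p := hρ.contDiffAt hpV
  have hρp : ρ p = 0 := by
    refine le_antisymm ?_ (hout p (hDV hp) hpD)
    by_contra! h
    have hev : ∀ᶠ z in 𝓝 p, 0 < ρ z ∧ z ∈ V :=
      (hρat.continuousAt.eventually (lt_mem_nhds h)).and hpV
    obtain ⟨z, ⟨hz1, hz2⟩, hz3⟩ := mem_closure_iff_nhds.1 hp.1 _ hev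
    exact absurd ((hmem z hz2).1 hz3) (not_lt.2 hz1.le)
  have hdp : fderiv ℝ ρ p p ≠ 0 :=
    fderiv_apply_ne_zero_of_supporting hpV (hρat.differentiableAt (by simp)) hρp hout hl
      (fun z hz => le_trans (by positivity) (hcontact z hz)) (hdρ p hp)
  obtain ⟨K₁, t₁, ht₁, hK₁⟩ := (hρat.of_le (by simp : (1 : WithTop ℕ∞) ≤ ∞)).exists_lipschitzOnWith
  obtain ⟨K₂, t₂, ht₂, hK₂⟩ := ContDiffAt.exists_lipschitzOnWith
    (hρat.fderiv_right (m := 1) (by norm_cast))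
  obtain ⟨s, hs0, hs⟩ := Metric.mem_nhds_iff.1 (inter_mem hpV (inter_mem ht₁ ht₂))
  -- Chosen so that the translate by `t p`, with `t ≤ ‖l‖ ‖z - p‖`, stays in the ball of radius `s`.
  set r := s / (1 + ‖l‖ * ‖p‖) with hr
  have hr0 : 0 < r := by positivity
  have hrs' : r + ‖l‖ * r * ‖p‖ = s := by
    rw [hr]; field_simp
  have hrs : r ≤ s := by
    rw [← hrs']
    have : 0 ≤ ‖l‖ * r * ‖p‖ := by positivity
    linarith
  have hball : Metric.ball p r ⊆ Metric.ball p s := Metric.ball_subset_ball hrs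
  have hballV : Metric.ball p r ⊆ V := fun z hz => (hs (hball hz)).1
  have hdiff : ∀ z ∈ V, DifferentiableAt ℝ ρ z := fun z hz =>
    (hρ.contDiffAt (hV.mem_nhds hz)).differentiableAt (by simp)
  have hdbar : ∀ z ∈ V, dbar p (fun y => ((-ρ y : ℝ) : ℂ)) z =
      -((fderiv ℝ ρ z p : ℂ) + Complex.I * (fderiv ℝ ρ z (Complex.I • p) : ℂ)) := by
    intro z hz
    rw [dbar_ofReal (hdiff z hz).fun_neg, fderiv_fun_neg]
    simp only [_root_.neg_apply, Complex.ofReal_neg]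
    ring
  refine ⟨p, l, fun z => -ρ z, c, r, K₁ * ‖p‖ + 2 * K₂ * ‖p‖,
    dbar p (fun y => ((-ρ y : ℝ) : ℂ)) p, hc, hr0, by positivity, ?_, hp.1, hl, hcontact, hpD,
    ?_, ?_, ?_, ?_, ?_⟩
  -- The real part of `a` is `-dρ_p(p)`, which is nonzero.
  · rw [hdbar p (hDV hp)]
    intro h
    have := congrArg Complex.re h
    simp at this
    exact hdp this
  · exact ((hρ.of_le (by simp)).mono fun z hz => hballV hz.2).neg
  · intro z hz
    have := (hmem z (hballV hz.2)).1 hz.1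
    linarith
  · intro z hz
    set t := (1 - l z).re with ht
    have ht0 : 0 ≤ t := le_trans (by positivity) (hcontact z hz.1)
    have hzr : ‖z - p‖ < r := by simpa [dist_eq_norm] using hz.2
    have htl : t ≤ ‖l‖ * ‖z - p‖ := by
      have : 1 - l z = - l (z - p) := by rw [map_sub, hl]; ring
      rw [ht, this]
      refine (Complex.re_le_norm _).trans ?_
      rw [norm_neg]
      exact l.le_opNorm _
    have hshift : z + t • p ∈ Metric.ball p s := by
      rw [Metric.mem_ball, dist_eq_norm]
      have h1 : z + t • p - p = (z - p) + t • p := by abel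
      rw [h1]
      refine (norm_add_le _ _).trans_lt ?_
      rw [norm_smul, Real.norm_of_nonneg ht0, ← hrs']
      have h2 : t * ‖p‖ ≤ ‖l‖ * r * ‖p‖ := by
        have : ‖l‖ * ‖z - p‖ ≤ ‖l‖ * r := by gcongr
        gcongr
        linarith
      linarith
    have hshiftD : z + t • p ∉ D := by
      intro hmemD
      have h1 := hcontact _ hmemD
      have h2 : (1 - l (z + t • p)).re = 0 := by
        rw [map_add, l.map_smul_of_tower t p, hl, ← sub_sub, Complex.sub_re, ← ht]
        simp
      rw [h2] at h1
      have h3 : ‖z + t • p - p‖ ^ 2 ≤ 0 := by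
        by_contra! h
        exact absurd h1 (not_le.2 (mul_pos hc h))
      have h4 : z + t • p - p = 0 := by
        rw [← norm_eq_zero]
        exact pow_eq_zero_iff two_ne_zero |>.1 (le_antisymm h3 (by positivity))
      rw [sub_eq_zero] at h4
      exact hpD (h4 ▸ hmemD)
    have h0 := hout _ (hs hshift).1 hshiftD
    have hlip := hK₁.dist_le_mul _ (hs hshift).2.1 _ (hs (hball hz.2)).2.1
    rw [dist_eq_norm, dist_eq_norm, add_sub_cancel_left, norm_smul, Real.norm_of_nonneg ht0]
      at hlip
    have h1 := (le_abs_self _).trans hlip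
    have h2 : 0 ≤ 2 * K₂ * ‖p‖ * t := by positivity
    calc -ρ z ≤ K₁ * (t * ‖p‖) := by linarith
      _ ≤ (K₁ * ‖p‖ + 2 * K₂ * ‖p‖) * t := by linarith
  · intro z hz
    have hlip := hK₂.dist_le_mul _ (hs (hball hz.2)).2.2 _
      (hs (Metric.mem_ball_self hs0)).2.2
    rw [dist_eq_norm, dist_eq_norm] at hlip
    rw [hdbar p (hDV hp), hdbar z (hballV hz.2)]
    have h1 : -((fderiv ℝ ρ p p : ℂ) + Complex.I * (fderiv ℝ ρ p (Complex.I • p) : ℂ)) -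
        -((fderiv ℝ ρ z p : ℂ) + Complex.I * (fderiv ℝ ρ z (Complex.I • p) : ℂ)) =
        (((fderiv ℝ ρ z - fderiv ℝ ρ p) p : ℝ) : ℂ) +
          Complex.I * (((fderiv ℝ ρ z - fderiv ℝ ρ p) (Complex.I • p) : ℝ) : ℂ) := by
      simp only [_root_.sub_apply, Complex.ofReal_sub]
      ring
    rw [h1]
    refine (norm_add_le _ _).trans ?_
    rw [norm_mul, Complex.norm_I, one_mul, Complex.norm_real, Complex.norm_real]
    have h2 := (fderiv ℝ ρ z - fderiv ℝ ρ p).le_of_opNorm_le hlip p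
    have h3 := (fderiv ℝ ρ z - fderiv ℝ ρ p).le_of_opNorm_le hlip (Complex.I • p)
    rw [norm_smul, Complex.norm_I, one_mul] at h3
    have h4 : 0 ≤ K₁ * ‖p‖ * ‖z - p‖ := by positivity
    linarith
  · intro ε hε
    have hcb : Metric.closedBall p (r / 2) ⊆ Metric.ball p r :=
      Metric.closedBall_subset_ball (by linarith)
    refine ⟨closure D ∩ (Metric.closedBall p (r / 2) ∩ (fun z => -ρ z) ⁻¹' Set.Ici ε), ?_, ?_, ?_⟩
    · refine hb.isCompact_closure.inter_right ?_
      refine ContinuousOn.preimage_isClosed_of_isClosed (fun z hz => ?_) Metric.isClosed_closedBall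
        isClosed_Ici
      exact (hdiff z (hballV (hcb hz))).continuousAt.neg.continuousWithinAt
    · rintro z ⟨-, hz2, hz3⟩
      have hz3' : ε ≤ -ρ z := hz3
      exact ⟨(hmem z (hballV (hcb hz2))).2 (by linarith), hcb hz2⟩
    · intro z hz h1 h2
      exact ⟨subset_closure hz, by simpa [dist_eq_norm] using h1, h2⟩

/-! ### The uniform estimate for logarithms -/

/-- The logarithm is `O(|w| ^ (-1/2))` on bounded parts of the right half plane. -/
theorem exists_sqrt_norm_mul_norm_log_le (A : ℝ) :
    ∃ C, 0 ≤ C ∧ ∀ w : ℂ, 0 < w.re → ‖w‖ ≤ A → √‖w‖ * ‖Complex.log w‖ ≤ C := by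
  refine ⟨2 * (|A| + 1) + √|A| * Real.pi, by positivity, fun w hw hA => ?_⟩
  have hA' := hA.trans (le_abs_self A)
  have hw0 : 0 < ‖w‖ := norm_pos_iff.2 fun h => by simp [h] at hw
  set s := √‖w‖ with hs
  have hs0 : 0 < s := Real.sqrt_pos.2 hw0
  have hss : s * s = ‖w‖ := Real.mul_self_sqrt hw0.le
  have h1 : ‖Complex.log w‖ ≤ |Real.log ‖w‖| + Real.pi := by
    refine (Complex.norm_le_abs_re_add_abs_im _).trans ?_
    rw [Complex.log_re, Complex.log_im]
    gcongr
    exact Complex.abs_arg_le_pi w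
  have h2 : s * |Real.log ‖w‖| ≤ 2 * (‖w‖ + 1) := by
    rw [← hss, Real.log_mul hs0.ne' hs0.ne', ← two_mul, abs_mul, abs_two]
    -- From `log x ≤ x - 1`, applied to `s` or to `1 / s`.
    have h3 : s * |Real.log s| ≤ s * s + 1 := by
      rcases abs_cases (Real.log s) with ⟨h, -⟩ | ⟨h, -⟩
      · rw [h]
        nlinarith [Real.log_le_sub_one_of_pos hs0]
      · rw [h, ← Real.log_inv]
        have h4 := Real.log_le_sub_one_of_pos (inv_pos.2 hs0)
        have h5 : s * Real.log s⁻¹ ≤ s * s⁻¹ :=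
          mul_le_mul_of_nonneg_left (by linarith) hs0.le
        rw [mul_inv_cancel₀ hs0.ne'] at h5
        nlinarith
    linarith
  have h3 : s * Real.pi ≤ √|A| * Real.pi := by
    have := Real.sqrt_le_sqrt hA'
    gcongr
  have h4 := mul_le_mul_of_nonneg_left h1 hs0.le
  linarith

theorem integrableOn_of_norm_le_mul {n : ℕ} {U D : Set (Fin n → ℂ)} {f F : (Fin n → ℂ) → ℂ} {k : ℝ}
    (hU : IsOpen U) (hUD : U ⊆ D) (hf : IntegrableOn f D) (hF : ContinuousOn F U)
    (hb : ∀ x ∈ U, ‖F x‖ ≤ k * ‖f x‖) : IntegrableOn F U := by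
  refine ((hf.mono_set hUD).norm.const_mul k).mono' (hF.aestronglyMeasurable hU.measurableSet) ?_
  filter_upwards [ae_restrict_mem hU.measurableSet] with x hx
  exact hb x hx

theorem norm_setIntegral_le_mul {n : ℕ} {U D : Set (Fin n → ℂ)} {f F : (Fin n → ℂ) → ℂ} {k : ℝ}
    (hU : IsOpen U) (hUD : U ⊆ D) (hf : IntegrableOn f D) (hk : 0 ≤ k)
    (hb : ∀ x ∈ U, ‖F x‖ ≤ k * ‖f x‖) : ‖∫ x in U, F x‖ ≤ k * ∫ x in D, ‖f x‖ := by
  calc ‖∫ x in U, F x‖ ≤ ∫ x in U, k * ‖f x‖ := by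
        refine norm_integral_le_of_norm_le ((hf.mono_set hUD).norm.const_mul k) ?_
        filter_upwards [ae_restrict_mem hU.measurableSet] with x hx
        exact hb x hx
    _ = k * ∫ x in U, ‖f x‖ := integral_const_mul _ _
    _ ≤ k * ∫ x in D, ‖f x‖ := by
        refine mul_le_mul_of_nonneg_left ?_ hk
        exact setIntegral_mono_set hf.norm (Eventually.of_forall fun x => norm_nonneg _)
          hUD.eventuallyLE

namespace IsSupportedAt

variable {n : ℕ} {D : Set (Fin n → ℂ)} {p : Fin n → ℂ} {l : (Fin n → ℂ) →L[ℂ] ℂ}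
  {σ : (Fin n → ℂ) → ℝ} {c r C : ℝ} {a : ℂ}

theorem re_pos (H : IsSupportedAt D p l σ c r C a) {z : Fin n → ℂ} (hz : z ∈ D) :
    0 < (1 - l z).re := by
  have hne : z - p ≠ 0 := sub_ne_zero.2 fun h => H.notMem (h ▸ hz)
  have := norm_pos_iff.2 hne
  have hc := H.c_pos
  exact lt_of_lt_of_le (by positivity) (H.contact z hz)

theorem hasFDerivAt_log (H : IsSupportedAt D p l σ c r C a) {z : Fin n → ℂ} (hz : z ∈ D) {δ : ℝ}
    (hδ : 0 < δ) : HasFDerivAt (fun y => Complex.log (1 - l y + δ)) ((1 - l z + δ)⁻¹ • (-l)) z := by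
  refine HasFDerivAt.clog ((l.hasFDerivAt.const_sub 1).add_const _) (Or.inl ?_)
  rw [Complex.add_re, Complex.ofReal_re]
  linarith [H.re_pos hz]

/-- Logarithms of the supporting functional define functionals on the integrable holomorphic
functions on `D`, bounded uniformly with respect to the `L¹` norm. -/
theorem exists_norm_integral_mul_conj_log_le (H : IsSupportedAt D p l σ c r C a) (hD : IsOpen D)
    (hb : Bornology.IsBounded D) :
    ∃ M, 0 ≤ M ∧ ∀ δ : ℝ, 0 < δ → δ ≤ 1 → ∀ f : (Fin n → ℂ) → ℂ, DifferentiableOn ℂ f D →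
      IntegrableOn f D →
      ‖∫ z in D, f z * starRingEnd ℂ (Complex.log (1 - l z + δ))‖ ≤ M * ∫ z in D, ‖f z‖ := by
  have hc := H.c_pos
  have hr := H.r_pos
  have hC := H.C_nonneg
  have ha : 0 < ‖a‖ := norm_pos_iff.2 H.a_ne
  obtain ⟨R, hR⟩ := hb.exists_norm_le
  obtain ⟨Q, hQ, hlog⟩ := exists_sqrt_norm_mul_norm_log_le (2 + ‖l‖ * R)
  let b : ContDiffBump p := ⟨r / 4, r / 2, by positivity, by linarith⟩
  have hbsm : ContDiff ℝ 1 (fun y => (b y : ℂ)) := Complex.ofRealCLM.contDiff.comp b.contDiff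
  have hbcpt : HasCompactSupport (fun y => (b y : ℂ)) :=
    b.hasCompactSupport.comp_left (g := fun x : ℝ => (x : ℂ)) Complex.ofReal_zero
  obtain ⟨B, hB⟩ := (hbcpt.fderiv (𝕜 := ℝ)).exists_bound_of_continuous
    (hbsm.continuous_fderiv one_ne_zero)
  have hB0 : 0 ≤ B := (norm_nonneg _).trans (hB 0)
  set A := √(2 + ‖l‖ * R) with hA
  -- `M₁` bounds the integrated-by-parts term: `2 * C` from differentiating the logarithm, the rest
  -- from differentiating the bump. `M₂` bounds the error of replacing `a`.
  set M₁ := 2 * C + C * (A * Q) * (2 * (B * ‖p‖)) with hM₁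
  set M₂ := (‖a‖ * (4 / r) + C) * (Q / √c) with hM₂
  have hM₁0 : 0 ≤ M₁ := by positivity
  have hM₂0 : 0 ≤ M₂ := by positivity
  refine ⟨(M₁ + M₂) / ‖a‖, by positivity, fun δ hδ hδ1 f hf hfi => ?_⟩
  set g : (Fin n → ℂ) → ℂ := fun z => Complex.log (1 - l z + δ) with hg
  have hgd : ∀ z ∈ D, DifferentiableAt ℂ g z := fun z hz => (H.hasFDerivAt_log hz hδ).differentiableAt
  have hre : ∀ z ∈ D, 0 < (1 - l z + δ).re := fun z hz => by
    rw [Complex.add_re, Complex.ofReal_re]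
    linarith [H.re_pos hz]
  have hrele : ∀ z ∈ D, (1 - l z).re ≤ ‖1 - l z + δ‖ := fun z hz => by
    refine le_trans ?_ (Complex.re_le_norm _)
    rw [Complex.add_re, Complex.ofReal_re]
    linarith
  have hwle : ∀ z ∈ D, ‖1 - l z + δ‖ ≤ 2 + ‖l‖ * R := by
    intro z hz
    have h1 : ‖l z‖ ≤ ‖l‖ * R := (l.le_opNorm z).trans (by have := hR z hz; gcongr)
    have h2 : ‖(δ : ℂ)‖ ≤ 1 := by rwa [Complex.norm_real, Real.norm_of_nonneg hδ.le]
    have h3 := norm_add_le (1 - l z) (δ : ℂ)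
    have h4 := norm_sub_le (1 : ℂ) (l z)
    rw [norm_one] at h4
    linarith
  have hsq : ∀ z ∈ D, √‖1 - l z + δ‖ * ‖g z‖ ≤ Q := fun z hz => hlog _ (hre z hz) (hwle z hz)
  have hdist : ∀ z ∈ D, ‖z - p‖ * ‖g z‖ ≤ Q / √c := by
    intro z hz
    rw [le_div_iff₀ (Real.sqrt_pos.2 hc)]
    refine le_trans ?_ (hsq z hz)
    have h1 : √c * ‖z - p‖ ≤ √‖1 - l z + δ‖ := by
      refine Real.le_sqrt_of_sq_le ?_
      rw [mul_pow, Real.sq_sqrt hc.le]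
      exact (H.contact z hz).trans (hrele z hz)
    calc ‖z - p‖ * ‖g z‖ * √c = (√c * ‖z - p‖) * ‖g z‖ := by ring
      _ ≤ _ := by gcongr
  -- This bound degenerates as `δ → 0`; it serves integrability only and does not enter `M₁` or
  -- `M₂`.
  have hgbd : ∀ z ∈ D, ‖g z‖ ≤ Q / √δ := by
    intro z hz
    rw [le_div_iff₀ (Real.sqrt_pos.2 hδ), mul_comm]
    refine le_trans ?_ (hsq z hz)
    have : δ ≤ ‖1 - l z + δ‖ := by
      refine le_trans ?_ (Complex.re_le_norm _)
      rw [Complex.add_re, Complex.ofReal_re]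
      linarith [H.re_pos hz]
    gcongr
  set U := D ∩ Metric.ball p r with hU
  have hUo : IsOpen U := hD.inter Metric.isOpen_ball
  have hUD : U ⊆ D := Set.inter_subset_left
  have hσg : ∀ z ∈ U, σ z * ‖g z‖ ≤ C * (A * Q) := by
    intro z hz
    have h1 : σ z ≤ C * ‖1 - l z + δ‖ :=
      (H.le_re z hz).trans (mul_le_mul_of_nonneg_left (hrele z hz.1) hC)
    calc σ z * ‖g z‖ ≤ C * ‖1 - l z + δ‖ * ‖g z‖ := by gcongr
      _ = C * (√‖1 - l z + δ‖ * (√‖1 - l z + δ‖ * ‖g z‖)) := by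
          rw [← mul_assoc √_, Real.mul_self_sqrt (norm_nonneg _), mul_assoc]
      _ ≤ C * (A * Q) := by
          have h2 := Real.sqrt_le_sqrt (hwle z hz.1)
          have h3 := hsq z hz.1
          gcongr
  have hdg : ∀ z ∈ U, σ z * ‖dbar p (fun y => starRingEnd ℂ (g y)) z‖ ≤ 2 * C := by
    intro z hz
    have hw0 : 0 < ‖1 - l z + δ‖ := (hre z hz.1).trans_le (Complex.re_le_norm _)
    rw [dbar_conj (hgd z hz.1), (H.hasFDerivAt_log hz.1 hδ).fderiv]
    have h1 : ‖2 * starRingEnd ℂ (((1 - l z + δ)⁻¹ • (-l)) p)‖ = 2 * ‖1 - l z + δ‖⁻¹ := by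
      rw [norm_mul, RCLike.norm_conj, _root_.smul_apply, _root_.neg_apply, H.apply_eq_one]
      simp
    rw [h1]
    have h2 : σ z ≤ C * ‖1 - l z + δ‖ :=
      (H.le_re z hz).trans (mul_le_mul_of_nonneg_left (hrele z hz.1) hC)
    calc σ z * (2 * ‖1 - l z + δ‖⁻¹) ≤ C * ‖1 - l z + δ‖ * (2 * ‖1 - l z + δ‖⁻¹) := by gcongr
      _ = 2 * C := by field_simp
  have hfc : ContDiffOn ℝ 1 f U := (contDiffOn_one_of_differentiableOn hD hf).mono hUD
  have hgc : ContDiffOn ℝ 1 (fun y => starRingEnd ℂ (g y)) U :=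
    Complex.conjCLE.contDiff.comp_contDiffOn ((contDiffOn_one_of_differentiableOn hD
      fun z hz => (hgd z hz).differentiableWithinAt).mono hUD)
  have hmc : ContDiffOn ℝ 1 (fun y => starRingEnd ℂ (g y) * (b y : ℂ)) U :=
    hgc.mul hbsm.contDiffOn
  set G : (Fin n → ℂ) → ℂ := fun y => f y * (starRingEnd ℂ (g y) * (b y : ℂ)) with hG
  have hGc : ContDiffOn ℝ 1 G U := hfc.mul hmc
  have hσc : ContDiffOn ℝ 1 (fun y => (σ y : ℂ)) U :=
    Complex.ofRealCLM.contDiff.comp_contDiffOn H.contDiffOn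
  have hbnorm : ∀ z, ‖(b z : ℂ)‖ ≤ 1 := fun z => by
    rw [Complex.norm_real, Real.norm_of_nonneg b.nonneg]
    exact b.le_one
  -- No derivative of `f` appears, since `dbar` kills holomorphic factors.
  have hdG : ∀ z ∈ U, ‖(σ z : ℂ) * dbar p G z‖ ≤ M₁ * ‖f z‖ := by
    intro z hz
    have hn := hUo.mem_nhds hz
    have hfd : DifferentiableAt ℂ f z := hf.differentiableAt (hD.mem_nhds hz.1)
    rw [hG, dbar_mul (hfd.restrictScalars ℝ) ((hmc.differentiableOn one_ne_zero).differentiableAt hn),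
      dbar_eq_zero hfd, zero_mul, zero_add,
      dbar_mul ((hgc.differentiableOn one_ne_zero).differentiableAt hn)
        (hbsm.differentiable one_ne_zero z)]
    have h1 := norm_dbar_le p z (fun y => (b y : ℂ))
    have h2 := hB z
    have hσ0 := (H.pos z hz).le
    have h3 : ‖dbar p (fun y => (b y : ℂ)) z‖ ≤ 2 * (B * ‖p‖) := h1.trans (by gcongr)
    rw [norm_mul, norm_mul, Complex.norm_real, Real.norm_of_nonneg hσ0]
    calc σ z * (‖f z‖ * ‖dbar p (fun y => starRingEnd ℂ (g y)) z * (b z : ℂ) +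
          starRingEnd ℂ (g z) * dbar p (fun y => (b y : ℂ)) z‖)
        ≤ σ z * (‖f z‖ * (‖dbar p (fun y => starRingEnd ℂ (g y)) z‖ * 1 +
          ‖g z‖ * (2 * (B * ‖p‖)))) := by
          gcongr
          refine (norm_add_le _ _).trans ?_
          rw [norm_mul, norm_mul, RCLike.norm_conj]
          have := hbnorm z
          gcongr
      _ = (σ z * ‖dbar p (fun y => starRingEnd ℂ (g y)) z‖ +
          σ z * ‖g z‖ * (2 * (B * ‖p‖))) * ‖f z‖ := by ring
      _ ≤ M₁ * ‖f z‖ := by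
          have e1 := hσg z hz
          have e2 := hdg z hz
          rw [hM₁]
          gcongr
  have hGbd : ∀ z ∈ U, ‖dbar p (fun y => (σ y : ℂ)) z * G z‖ ≤
      (‖a‖ + C * r) * (Q / √δ) * ‖f z‖ := by
    intro z hz
    have h1 := H.norm_dbar_sub_le z hz
    have h2 : ‖z - p‖ ≤ r := by simpa [dist_eq_norm] using (Metric.mem_ball.1 hz.2).le
    have h3 : ‖dbar p (fun y => (σ y : ℂ)) z‖ ≤ ‖a‖ + C * r := by
      have e1 := norm_sub_norm_le (dbar p (fun y => (σ y : ℂ)) z) a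
      rw [norm_sub_rev] at e1
      have e2 : C * ‖z - p‖ ≤ C * r := by gcongr
      linarith
    have h4 : ‖G z‖ ≤ ‖f z‖ * (Q / √δ * 1) := by
      rw [hG, norm_mul, norm_mul, RCLike.norm_conj]
      have e1 := hgbd z hz.1
      have e2 := hbnorm z
      gcongr
    rw [norm_mul]
    calc _ ≤ (‖a‖ + C * r) * (‖f z‖ * (Q / √δ * 1)) := by gcongr
      _ = _ := by ring
  have hi₁ : IntegrableOn (fun z => dbar p (fun y => (σ y : ℂ)) z * G z) U :=
    integrableOn_of_norm_le_mul hUo hUD hfi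
      ((continuousOn_dbar hUo hσc).mul hGc.continuousOn) hGbd
  have hi₂ : IntegrableOn (fun z => (σ z : ℂ) * dbar p G z) U :=
    integrableOn_of_norm_le_mul hUo hUD hfi
      (hσc.continuousOn.mul (continuousOn_dbar hUo hGc)) hdG
  have hbzero : ∀ z, r / 2 ≤ ‖z - p‖ → b z = 0 := fun z hz =>
    b.zero_of_le_dist (by rwa [dist_eq_norm])
  have hibp := setIntegral_dbar_weight_mul hUo H.contDiffOn H.pos hGc (fun ε hε => by
    obtain ⟨K, hK, hKU, hKmem⟩ := H.exists_compact ε hε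
    refine ⟨K, hK, hKU, fun z hz hεz hzK => ?_⟩
    have : r / 2 ≤ ‖z - p‖ := by
      by_contra! h
      exact hzK (hKmem z hz.1 h.le hεz)
    simp [hG, hbzero z this]) p hi₁ hi₂
  have hdiff0 : ∀ z ∈ D \ U, dbar p (fun y => (σ y : ℂ)) z * G z = 0 := by
    intro z hz
    have h1 : r / 2 ≤ ‖z - p‖ := by
      by_contra! h
      refine hz.2 ⟨hz.1, ?_⟩
      rw [Metric.mem_ball, dist_eq_norm]
      linarith
    simp [hG, hbzero z h1]
  have hi₁' : IntegrableOn (fun z => dbar p (fun y => (σ y : ℂ)) z * G z) D :=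
    hi₁.of_forall_sdiff_eq_zero hD.measurableSet hdiff0
  have hfg : IntegrableOn (fun z => f z * starRingEnd ℂ (g z)) D := by
    refine integrableOn_of_norm_le_mul (k := Q / √δ) hD subset_rfl hfi ?_ fun z hz => ?_
    · exact hf.continuousOn.mul (Complex.continuous_conj.comp_continuousOn
        fun z hz => (hgd z hz).continuousAt.continuousWithinAt)
    · rw [norm_mul, RCLike.norm_conj, mul_comm]
      exact mul_le_mul_of_nonneg_right (hgbd z hz) (norm_nonneg _)
  have hsplit : a * ∫ z in D, f z * starRingEnd ℂ (g z) =
      (∫ z in D, (a * (f z * starRingEnd ℂ (g z)) - dbar p (fun y => (σ y : ℂ)) z * G z)) +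
        ∫ z in U, dbar p (fun y => (σ y : ℂ)) z * G z := by
    rw [integral_sub (hfg.const_mul a) hi₁', integral_const_mul,
      setIntegral_eq_of_subset_of_forall_sdiff_eq_zero hD.measurableSet hUD hdiff0]
    ring
  have hcoef : ∀ z ∈ D, ‖a - dbar p (fun y => (σ y : ℂ)) z * (b z : ℂ)‖ ≤
      (‖a‖ * (4 / r) + C) * ‖z - p‖ := by
    intro z hz
    -- The bump equals `1` within `r / 4` of `p`, and beyond that the right side is at least `1`.
    have h1 : 1 - b z ≤ 4 / r * ‖z - p‖ := by
      rcases le_total ‖z - p‖ (r / 4) with h | h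
      · rw [b.one_of_mem_closedBall (by simpa [dist_eq_norm] using h), sub_self]
        positivity
      · have e1 : 1 ≤ 4 / r * ‖z - p‖ := by
          rw [div_mul_eq_mul_div, le_div_iff₀ hr]
          linarith
        linarith [b.nonneg (x := z)]
    have h2 : ‖(a - dbar p (fun y => (σ y : ℂ)) z) * (b z : ℂ)‖ ≤ C * ‖z - p‖ := by
      by_cases hzU : z ∈ U
      · rw [norm_mul, ← mul_one (C * ‖z - p‖)]
        exact mul_le_mul (H.norm_dbar_sub_le z hzU) (hbnorm z) (norm_nonneg _) (by positivity)
      · have h3 : r / 2 ≤ ‖z - p‖ := by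
          by_contra! h
          refine hzU ⟨hz, ?_⟩
          rw [Metric.mem_ball, dist_eq_norm]
          linarith
        rw [hbzero z h3, Complex.ofReal_zero, mul_zero, norm_zero]
        positivity
    have h3 : a - dbar p (fun y => (σ y : ℂ)) z * (b z : ℂ) =
        a * ((1 - b z : ℝ) : ℂ) + (a - dbar p (fun y => (σ y : ℂ)) z) * (b z : ℂ) := by
      push_cast
      ring
    rw [h3]
    refine (norm_add_le _ _).trans ?_
    rw [norm_mul, Complex.norm_real, Real.norm_of_nonneg (sub_nonneg.2 b.le_one)]
    have h4 := mul_le_mul_of_nonneg_left h1 ha.le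
    linarith
  have hN₂ : ‖∫ z in D, (a * (f z * starRingEnd ℂ (g z)) - dbar p (fun y => (σ y : ℂ)) z * G z)‖ ≤
      M₂ * ∫ z in D, ‖f z‖ := by
    refine norm_setIntegral_le_mul hD subset_rfl hfi hM₂0 fun z hz => ?_
    have h1 : a * (f z * starRingEnd ℂ (g z)) - dbar p (fun y => (σ y : ℂ)) z * G z =
        (a - dbar p (fun y => (σ y : ℂ)) z * (b z : ℂ)) * starRingEnd ℂ (g z) * f z := by
      rw [hG]; ring
    rw [h1, norm_mul, norm_mul, RCLike.norm_conj]
    gcongr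
    calc _ ≤ (‖a‖ * (4 / r) + C) * ‖z - p‖ * ‖g z‖ := by
          have := hcoef z hz
          gcongr
      _ = (‖a‖ * (4 / r) + C) * (‖z - p‖ * ‖g z‖) := by ring
      _ ≤ M₂ := by
          have := hdist z hz
          rw [hM₂]
          gcongr
  have hN₁ : ‖∫ z in U, dbar p (fun y => (σ y : ℂ)) z * G z‖ ≤ M₁ * ∫ z in D, ‖f z‖ := by
    rw [hibp, norm_neg]
    exact norm_setIntegral_le_mul hUo hUD hfi hM₁0 hdG
  rw [div_mul_eq_mul_div, le_div_iff₀ ha, mul_comm, ← norm_mul, hsplit]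
  refine (norm_add_le _ _).trans ?_
  linarith

end IsSupportedAt

/-! ### Duality and the contradiction -/

/-- The pairing of the Bergman projection of an indicator function with a function in the Bergman
space. -/
theorem norm_setIntegral_eq_of_bergmanProjection {n : ℕ} {D : Opens (Fin n → ℂ)}
    {f g : (Fin n → ℂ) → ℂ} {Q : Set (Fin n → ℂ)} (hQ : MeasurableSet Q)
    (hQt : volume.restrict (D : Set (Fin n → ℂ)) Q ≠ ⊤) (hg : DifferentiableOn ℂ g D)
    (hgm : MemLp g 2 (volume.restrict (D : Set (Fin n → ℂ))))
    (hf : bergmanProjection D (indicatorConstLp 2 hQ hQt (1 : ℂ))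
      =ᵐ[volume.restrict (D : Set (Fin n → ℂ))] f) :
    ‖∫ z in Q, g z ∂(volume.restrict (D : Set (Fin n → ℂ)))‖ =
      ‖∫ z in (D : Set (Fin n → ℂ)), f z * starRingEnd ℂ (g z)‖ := by
  have hmem : hgm.toLp g ∈ bergmanSpace D := ⟨g, hg, hgm.coeFn_toLp⟩
  have h := Submodule.starProjection_inner_eq_zero (K := bergmanSpace D)
    (indicatorConstLp 2 hQ hQt (1 : ℂ)) _ hmem
  rw [inner_sub_left, sub_eq_zero, L2.inner_indicatorConstLp_one, L2.inner_def] at h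
  have h1 : ∫ z in Q, g z ∂(volume.restrict (D : Set (Fin n → ℂ))) =
      ∫ z in Q, hgm.toLp g z ∂(volume.restrict (D : Set (Fin n → ℂ))) :=
    integral_congr_ae (ae_restrict_of_ae hgm.coeFn_toLp.symm)
  have h2 : ∫ z in (D : Set (Fin n → ℂ)),
      inner ℂ ((bergmanSpace D).starProjection (indicatorConstLp 2 hQ hQt (1 : ℂ)) z)
        (hgm.toLp g z) = ∫ z in (D : Set (Fin n → ℂ)),
          starRingEnd ℂ (f z * starRingEnd ℂ (g z)) := by
    refine integral_congr_ae ?_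
    filter_upwards [hgm.coeFn_toLp, hf] with z hz1 hz2
    rw [bergmanProjection] at hz2
    rw [hz1, hz2, RCLike.inner_apply, map_mul, Complex.conj_conj, mul_comm]
  rw [h1, h, h2, integral_conj, RCLike.norm_conj]

/-- The shift `δ` keeps the argument in the open right half plane up to the closure of `D`, so the
logarithm is continuous on a compact set. -/
theorem IsSupportedAt.memLp_log {n : ℕ} {D : Set (Fin n → ℂ)} {p : Fin n → ℂ}
    {l : (Fin n → ℂ) →L[ℂ] ℂ} {σ : (Fin n → ℂ) → ℝ} {c r C : ℝ} {a : ℂ}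
    (H : IsSupportedAt D p l σ c r C a) (hD : IsOpen D) (hb : Bornology.IsBounded D) {δ : ℝ}
    (hδ : 0 < δ) (q : ENNReal) :
    MemLp (fun z => Complex.log (1 - l z + δ)) q (volume.restrict D) := by
  have : IsFiniteMeasure (volume.restrict D) := ⟨by
    rw [Measure.restrict_apply_univ]
    exact hb.measure_lt_top⟩
  have hre : ∀ z ∈ closure D, 0 ≤ (1 - l z).re := by
    intro z hz
    have hcl : IsClosed {z | 0 ≤ (1 - l z).re} := isClosed_le continuous_const (by fun_prop)
    exact hcl.closure_subset_iff.2 (fun z hz => (H.re_pos hz).le) hz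
  have hcont : ContinuousOn (fun z => Complex.log (1 - l z + δ)) (closure D) := by
    refine ContinuousOn.clog (by fun_prop) fun z hz => Or.inl ?_
    rw [Complex.add_re, Complex.ofReal_re]
    linarith [hre z hz]
  obtain ⟨K, hK⟩ := hb.isCompact_closure.exists_bound_of_continuousOn hcont
  refine MemLp.of_bound ((hcont.mono subset_closure).aestronglyMeasurable hD.measurableSet) K ?_
  filter_upwards [ae_restrict_mem hD.measurableSet] with z hz
  exact hK z (subset_closure hz)

/-- Taking `z` near `p` and `δ` small, each of `‖1 - l z‖` and `δ` is at most `exp (-T) / 2`. -/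
theorem IsSupportedAt.exists_le_norm_log {n : ℕ} {D : Set (Fin n → ℂ)} {p : Fin n → ℂ}
    {l : (Fin n → ℂ) →L[ℂ] ℂ} {σ : (Fin n → ℂ) → ℝ} {c r C : ℝ} {a : ℂ}
    (H : IsSupportedAt D p l σ c r C a) (T : ℝ) :
    ∃ z ∈ D, ∃ δ : ℝ, 0 < δ ∧ δ ≤ 1 ∧ T ≤ ‖Complex.log (1 - l z + δ)‖ := by
  set η := Real.exp (-T) / 2 with hη
  have hη0 : 0 < η := by positivity
  have hnhds : {z | ‖1 - l z‖ < η} ∈ 𝓝 p := by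
    refine IsOpen.mem_nhds (isOpen_lt (by fun_prop) continuous_const) ?_
    simpa [H.apply_eq_one] using hη0
  obtain ⟨z, hz, hzD⟩ := mem_closure_iff_nhds.1 H.mem_closure _ hnhds
  have hδ : 0 < min η 1 := lt_min hη0 one_pos
  refine ⟨z, hzD, min η 1, hδ, min_le_right _ _, ?_⟩
  set w : ℂ := 1 - l z + (min η 1 : ℝ) with hw
  have hw0 : 0 < ‖w‖ := by
    refine lt_of_lt_of_le ?_ (Complex.re_le_norm w)
    rw [hw, Complex.add_re, Complex.ofReal_re]
    linarith [H.re_pos hzD]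
  have hwle : ‖w‖ ≤ Real.exp (-T) := by
    refine (norm_add_le _ _).trans ?_
    rw [Complex.norm_real, Real.norm_of_nonneg hδ.le]
    have h1 : ‖1 - l z‖ < η := hz
    linarith [min_le_left η 1]
  have h1 : Real.log ‖w‖ ≤ -T := (Real.log_le_iff_le_exp hw0).2 hwle
  refine le_trans ?_ (Complex.abs_re_le_norm _)
  rw [Complex.log_re]
  exact le_trans (by linarith) (neg_le_abs _)

/-- The Bergman projection of a bounded smoothly bounded domain is unbounded on `L¹`. -/
theorem not_isBoundedOnLp_one {n : ℕ} (hn : 1 ≤ n) (D : Opens (Fin n → ℂ))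
    (hconn : IsConnected (D : Set (Fin n → ℂ)))
    (hbdd : Bornology.IsBounded (D : Set (Fin n → ℂ)))
    (hsmooth : IsSmoothlyBounded (D : Set (Fin n → ℂ))) :
    ¬ IsBoundedOnLp (bergmanProjection D) 1 := by
  rintro ⟨C, hC⟩
  obtain ⟨p, l, σ, c, r, C', a, H⟩ :=
    exists_isSupportedAt hn D.isOpen hconn.nonempty hbdd hsmooth
  obtain ⟨M, hM, hbound⟩ := H.exists_norm_integral_mul_conj_log_le D.isOpen hbdd
  -- Duality bounds the mean of `g` over `Q` by `M * C`, the oscillation of `g` on `Q` costs `1`,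
  -- and another `1` makes the contradiction strict.
  obtain ⟨z, hzD, δ, hδ, hδ1, hT⟩ := H.exists_le_norm_log (M * C + 2)
  set g : (Fin n → ℂ) → ℂ := fun z => Complex.log (1 - l z + δ) with hg
  have hgd : ∀ y ∈ D, DifferentiableAt ℂ g y := fun y hy =>
    (H.hasFDerivAt_log hy hδ).differentiableAt
  obtain ⟨s, hs, hsub⟩ := Metric.mem_nhds_iff.1 (inter_mem (D.isOpen.mem_nhds hzD)
    ((hgd z hzD).continuousAt (Metric.ball_mem_nhds (g z) one_pos)))
  set μ := volume.restrict (D : Set (Fin n → ℂ)) with hμ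
  have : IsFiniteMeasure μ := ⟨by
    rw [hμ, Measure.restrict_apply_univ]
    exact hbdd.measure_lt_top⟩
  set Q := Metric.ball z s with hQ
  have hQm : MeasurableSet Q := measurableSet_ball
  have hQt : μ Q ≠ ⊤ := measure_ne_top μ Q
  have hQpos : 0 < μ.real Q := by
    refine ENNReal.toReal_pos ?_ hQt
    rw [hμ, Measure.restrict_eq_self _ fun y hy => (hsub hy).1]
    exact (Metric.measure_ball_pos _ _ hs).ne'
  have hgm : MemLp g 2 μ := H.memLp_log D.isOpen hbdd hδ 2
  obtain ⟨f, hfd, hfae⟩ : bergmanProjection D (indicatorConstLp 2 hQm hQt (1 : ℂ)) ∈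
      bergmanSpace D := Submodule.starProjection_apply_mem _ _
  have hfi : Integrable f μ := ((memLp_one_iff_integrable.1
    ((Lp.memLp _).mono_exponent (by norm_num))).congr hfae)
  have hpair := norm_setIntegral_eq_of_bergmanProjection hQm hQt
    (fun y hy => (hgd y hy).differentiableWithinAt) hgm hfae
  have hle := hbound δ hδ hδ1 f hfd hfi
  have hnorm : ∫ y in (D : Set (Fin n → ℂ)), ‖f y‖ ≤ C * μ.real Q := by
    have h1 := hC (indicatorConstLp 2 hQm hQt (1 : ℂ))
      ((Lp.memLp _).mono_exponent (by norm_num))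
    rw [eLpNorm_congr_ae hfae, eLpNorm_congr_ae indicatorConstLp_coeFn,
      eLpNorm_indicator_const hQm one_ne_zero ENNReal.one_ne_top,
      eLpNorm_one_eq_lintegral_enorm] at h1
    rw [integral_norm_eq_lintegral_enorm hfi.1]
    have h2 := ENNReal.toReal_mono (by finiteness) h1
    simpa [Measure.real] using h2
  have hlow : ‖g z‖ * μ.real Q - μ.real Q ≤ ‖∫ y in Q, g y ∂μ‖ := by
    have hgi : IntegrableOn g Q μ :=
      (memLp_one_iff_integrable.1 (hgm.mono_exponent (by norm_num))).integrableOn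
    have h1 : ‖∫ y in Q, (g y - g z) ∂μ‖ ≤ 1 * μ.real Q := by
      refine norm_setIntegral_le_of_norm_le_const hQt.lt_top fun y hy => ?_
      have := (hsub hy).2
      rw [Set.mem_preimage, Metric.mem_ball, dist_eq_norm] at this
      exact this.le
    rw [integral_sub hgi (integrable_const _), setIntegral_const] at h1
    have h2 := norm_sub_norm_le (μ.real Q • g z) (∫ y in Q, g y ∂μ)
    rw [norm_sub_rev, norm_smul, Real.norm_of_nonneg hQpos.le] at h2
    linarith
  have h1 : M * ∫ y in (D : Set (Fin n → ℂ)), ‖f y‖ ≤ M * (C * μ.real Q) :=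
    mul_le_mul_of_nonneg_left hnorm hM
  have h2 : (M * C + 2) * μ.real Q ≤ ‖g z‖ * μ.real Q :=
    mul_le_mul_of_nonneg_right hT hQpos.le
  linarith

end Bergman

theorem mainTheorem6 {n : ℕ} (hn : 1 ≤ n) (D : TopologicalSpace.Opens (Fin n → ℂ))
    (hconn : IsConnected (D : Set (Fin n → ℂ)))
    (hbdd : Bornology.IsBounded (D : Set (Fin n → ℂ)))
    (hsmooth : Bergman.IsSmoothlyBounded (D : Set (Fin n → ℂ))) :
    ¬ Bergman.IsBoundedOnLp (Bergman.bergmanProjection D) 1 := by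
  exact Bergman.not_isBoundedOnLp_one hn D hconn hbdd hsmooth
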